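/- Let $n, k \ge 0$ be integers. For a real $k\times n$ matrix $W$ and vectors $b\in\mathbb{R}^n$, $c\in\mathbb{R}^k$, put $\psi(v,h)=\exp(h^\top W v+b^\top v+c^\top h)$ for $v\in\{0,1\}^n$, $h\in\{0,1\}^k$, put $Z=\sum_{v,h}\psi(v,h)$, and let $p_{W,b,c}(v)=\frac1Z\sum_{h\in\{0,1\}^k}\psi(v,h)$. The restricted Boltzmann machine (RBM) model with $n$ visible and $k$ hidden nodes is the set $M_n^k=\{(p_{W,b,c}(v))_{v\in\{0,1\}^n} : W\in\mathbb{R}^{k\times n},\ b\in\mathbb{R}^n,\ c\in\mathbb{R}^k\}\subset\mathbb{R}^{2^n}$. Then $M_n^k$ is a semialgebraic subset of the open probability simplex $\Delta_{2^n-1}=\{p\in\mathbb{R}^{2^n} : p(v)>0 \text{ for all } v,\ \sum_v p(v)=1\}$, and it has the expected dimension $$\dim M_n^k=\min\{nk+n+k,\ 2^n-1\}$$ whenever $k\le 2^{\,n-\lceil\log_2(n+1)\rceil}$, and also whenever $k\ge 2^{\,n-\lfloor\log_2(n+1)\rfloor}$. Here a subset of $\mathbb{R}^N$ is semialgebraic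 if it is a finite Boolean combination of sets of the form $\{x : f(x)>0\}$ with $f$ a real polynomial, and the dimension of a semialgebraic set $S$ is the Krull dimension of $\mathbb{R}[x_1,\dots,x_N]/I(S)$, where $I(S)$ is the ideal of real polynomials vanishing on $S$. -/

import Mathlib

open scoped Matrix

noncomputable section

/-- The state vector `v ∈ {0,1}^m`, regarded as a vector in `ℝ^m`. -/
def stateVec {m : ℕ} (v : Fin m → Fin 2) : Fin m → ℝ := fun i => ((v i : ℕ) : ℝ)

/-- `ψ(v,h) = exp(hᵀ W v + bᵀ v + cᵀ h)`. -/
def rbmPsi {n k : ℕ} (W : Matrix (Fin k) (Fin n) ℝ) (b : Fin n → ℝ) (c : Fin k → ℝ)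
    (v : Fin n → Fin 2) (h : Fin k → Fin 2) : ℝ :=
  Real.exp (stateVec h ⬝ᵥ (W *ᵥ stateVec v) + b ⬝ᵥ stateVec v + c ⬝ᵥ stateVec h)

/-- The partition function `Z = ∑_{v,h} ψ(v,h)`. -/
def rbmZ {n k : ℕ} (W : Matrix (Fin k) (Fin n) ℝ) (b : Fin n → ℝ) (c : Fin k → ℝ) : ℝ :=
  ∑ v : Fin n → Fin 2, ∑ h : Fin k → Fin 2, rbmPsi W b c v h

/-- The distribution of the visible variables, `p(v) = (1/Z) ∑_h ψ(v,h)`. -/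
def rbmProb {n k : ℕ} (W : Matrix (Fin k) (Fin n) ℝ) (b : Fin n → ℝ) (c : Fin k → ℝ)
    (v : Fin n → Fin 2) : ℝ :=
  1 / rbmZ W b c * ∑ h : Fin k → Fin 2, rbmPsi W b c v h

/-- The RBM model `M_n^k` with `n` visible and `k` hidden nodes: all distributions
`(p(v) : v ∈ {0,1}^n)` as the parameters `W, b, c` run over all real values. -/
def rbmModel (n k : ℕ) : Set ((Fin n → Fin 2) → ℝ) :=
  {p | ∃ (W : Matrix (Fin k) (Fin n) ℝ) (b : Fin n → ℝ) (c : Fin k → ℝ), p = rbmProb W b c}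

/-- The open probability simplex in `ℝ^ι`; for `ι = {0,1}^n` it is `Δ_{2^n-1}`. -/
def openSimplex (ι : Type*) [Fintype ι] : Set (ι → ℝ) :=
  {p | (∀ i, 0 < p i) ∧ ∑ i, p i = 1}

/-- Semialgebraic subsets of `ℝ^ι`: the smallest class of sets that contains all the sets
`{x | f(x) > 0}` with `f` a real polynomial, and is closed under finite unions,
finite intersections and complements. -/
inductive IsSemialgebraic {ι : Type*} : Set (ι → ℝ) → Prop
  | pos (f : MvPolynomial ι ℝ) : IsSemialgebraic {x | 0 < MvPolynomial.eval x f}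
  | union {S T : Set (ι → ℝ)} : IsSemialgebraic S → IsSemialgebraic T → IsSemialgebraic (S ∪ T)
  | inter {S T : Set (ι → ℝ)} : IsSemialgebraic S → IsSemialgebraic T → IsSemialgebraic (S ∩ T)
  | compl {S : Set (ι → ℝ)} : IsSemialgebraic S → IsSemialgebraic Sᶜ

/-- The dimension of a semialgebraic set `S ⊆ ℝ^ι`, in the standard definition of real algebraic
geometry (Bochnak, Coste and Roy): the Krull dimension of `ℝ[X] / I(S)`, where `I(S)` is the
ideal of all real polynomials that vanish on `S`. -/
def semialgebraicDim {ι : Type*} (S : Set (ι → ℝ)) : WithBot ℕ∞ :=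
  ringKrullDim (MvPolynomial ι ℝ ⧸ MvPolynomial.vanishingIdeal ℝ S)

end

/-! Once the parameters are exponentiated, the model is the image of an open orthant under a
rational map. The Tarski–Seidenberg theorem makes it semialgebraic, and its coordinate ring embeds
in a localized polynomial ring in nk+n+k variables. So the dimension is a transcendence degree, at
most nk+n+k, and at most 2^n-1 because the model lies in the hyperplane Σ p(v) = 1.

For the lower bound, the rank of the differential of the parametrization at any point suffices
(`le_semialgebraicDim_of_slicingMap`). Summing out the hidden nodes gives, up to a constant, log
p(v) = bᵀv + Σᵢ log(1+exp(Wᵢv+cᵢ)), so the differential consists of affine functions of v and affine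
functions multiplied by sigmoids. When the parameters are scaled to infinity, the sigmoids become
indicators of half-space slices of the cube. Rank is lower semicontinuous, so it is enough to find k
slices for which the limit map is injective or surjective (`semialgebraicDim_of_injective`,
`semialgebraicDim_of_surjective`).

Hamming balls of radius one are slices on which affine functions interpolate arbitrary values.
Disjoint balls give injectivity if an affine function vanishing on the uncovered vertices must be
zero; balls covering all vertices but at most one give surjectivity. The centres are words of binary
linear codes: distinct nonzero parity check columns give a packing, columns exhausting the nonzero
vectors a covering. When a packing uses every codeword, an uncovered coset does the detecting
(`detectsAffine_coset`). The cubes of dimension 4 and 5 are too small for this and get explicit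
slices. -/

/-! ### Krull dimension and transcendence degree. -/

theorem ringKrullDim_eq_of_isIntegral_of_injective {A B : Type*} [CommRing A] [CommRing B]
    [Algebra A B] [Algebra.IsIntegral A B] (h : Function.Injective (algebraMap A B)) :
    ringKrullDim B = ringKrullDim A := by
  refine le_antisymm ?_ ?_
  -- Incomparability: strict inclusions of primes stay strict after contraction along an integral
  -- map.
  · refine Order.krullDim_le_of_strictMono (PrimeSpectrum.comap (algebraMap A B)) ?_
    intro p q hpq
    exact Ideal.IsIntegral.comap_lt_comap (R := A) (I := p.asIdeal) (J := q.asIdeal) hpq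
  -- Lying over for the smallest prime of the chain, going up for the rest.
  · refine iSup_le fun l => ?_
    obtain ⟨Q, -, hQ, hQl⟩ := Ideal.exists_ideal_over_prime_of_isIntegral (S := B) l.head.asIdeal ⊥
      (by rw [← RingHom.ker_eq_comap_bot, (RingHom.injective_iff_ker_eq_bot _).1 h]; exact bot_le)
    have : Q.LiesOver l.head.asIdeal := ⟨hQl.symm⟩
    obtain ⟨L, hL, -⟩ := Ideal.exists_ltSeries_of_hasGoingUp (S := B) l Q
    rw [← hL]
    exact Order.LTSeries.length_le_krullDim L

/-- Noether normalization: neither invariant changes along an injective integral extension, and both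
equal `s` for a polynomial ring in `s` variables. -/
theorem ringKrullDim_eq_trdeg (k R : Type*) [Field k] [CommRing R] [IsDomain R] [Algebra k R]
    [Algebra.FiniteType k R] :
    ∃ s : ℕ, ringKrullDim R = (s : WithBot ℕ∞) ∧ Algebra.trdeg k R = s := by
  obtain ⟨s, g, hg, hi⟩ := exists_integral_inj_algHom_of_fg k R
  refine ⟨s, ?_, ?_⟩
  · algebraize [g.toRingHom]
    have : Algebra.IsIntegral (MvPolynomial (Fin s) k) R := ⟨hi⟩
    rw [ringKrullDim_eq_of_isIntegral_of_injective (A := MvPolynomial (Fin s) k) (B := R) hg]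
    simp
  · let := g.toRingHom.toAlgebra
    have : IsScalarTower k (MvPolynomial (Fin s) k) R := IsScalarTower.of_algebraMap_eq' (by
      ext; exact (g.commutes _).symm)
    have : Algebra.IsIntegral (MvPolynomial (Fin s) k) R := ⟨hi⟩
    have : FaithfulSMul (MvPolynomial (Fin s) k) R := (faithfulSMul_iff_algebraMap_injective _ _).2 hg
    have h1 := lift_trdeg_add_eq k (MvPolynomial (Fin s) k) R
    rw [trdeg_eq_zero (R := MvPolynomial (Fin s) k)] at h1
    simpa [Cardinal.lift_eq_nat_iff] using h1.symm

/-! ### Dimension bounds for rationally parametrized sets. -/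

theorem trdeg_localizationAway {σ : Type} [Finite σ] (Z : MvPolynomial σ ℝ) (hZ : Z ≠ 0) :
    Algebra.trdeg ℝ (Localization.Away Z) = Nat.card σ := by
  have hle : Submonoid.powers Z ≤ nonZeroDivisors (MvPolynomial σ ℝ) :=
    powers_le_nonZeroDivisors_of_noZeroDivisors hZ
  have : IsDomain (Localization.Away Z) := IsLocalization.isDomain_localization hle
  have : FaithfulSMul (MvPolynomial σ ℝ) (Localization.Away Z) :=
    (faithfulSMul_iff_algebraMap_injective _ _).2 (IsLocalization.injective _ hle)
  have : Algebra.IsAlgebraic (MvPolynomial σ ℝ) (Localization.Away Z) :=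
    IsLocalization.isAlgebraic _ (Submonoid.powers Z)
  have h1 := trdeg_add_eq ℝ (MvPolynomial σ ℝ) (A := Localization.Away Z)
  rw [trdeg_eq_zero (R := MvPolynomial σ ℝ)] at h1
  rw [← h1]
  simpa using Nat.cast_card.symm

theorem MvPolynomial.eq_zero_of_eval_pos_eq_zero {σ : Type*} (f : MvPolynomial σ ℝ)
    (h : ∀ x : σ → ℝ, (∀ i, 0 < x i) → eval x f = 0) : f = 0 :=
  funext_set (fun _ => Set.Ioi 0) (fun _ => Set.Ioi_infinite _) fun x hx => by
    rw [map_zero]; exact h x fun i => hx i trivial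

/-- The set parametrized by the rational functions `g v / Z` on the open positive orthant. -/
def rationalImage {ι σ : Type*} (g : ι → MvPolynomial σ ℝ) (Z : MvPolynomial σ ℝ) :
    Set (ι → ℝ) :=
  {p | ∃ x : σ → ℝ, (∀ i, 0 < x i) ∧ p = fun v => MvPolynomial.eval x (g v) / MvPolynomial.eval x Z}

/-- The map sends `X v` to the fraction `g v / Z`. Its kernel is exactly the vanishing ideal,
because a fraction that vanishes at all positive points has a numerator vanishing on an orthant,
hence zero. -/
theorem exists_injective_algHom_coordinateRing {ι σ : Type*} (g : ι → MvPolynomial σ ℝ)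
    (Z : MvPolynomial σ ℝ) (hZ : ∀ x : σ → ℝ, (∀ i, 0 < x i) → 0 < MvPolynomial.eval x Z) :
    ∃ φ : (MvPolynomial ι ℝ ⧸ MvPolynomial.vanishingIdeal ℝ (rationalImage g Z)) →ₐ[ℝ]
      Localization.Away Z, Function.Injective φ := by
  let Φ : MvPolynomial ι ℝ →ₐ[ℝ] Localization.Away Z :=
    MvPolynomial.aeval fun v => algebraMap _ _ (g v) * IsLocalization.Away.invSelf Z
  have hunit : ∀ x : σ → ℝ, (∀ i, 0 < x i) → IsUnit (MvPolynomial.eval x Z) :=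
    fun x hx => (hZ x hx).ne'.isUnit
  have heval : ∀ (x : σ → ℝ) (hx : ∀ i, 0 < x i) (f : MvPolynomial ι ℝ),
      IsLocalization.Away.lift Z (hunit x hx) (Φ f) =
        MvPolynomial.eval (fun v => MvPolynomial.eval x (g v) / MvPolynomial.eval x Z) f := by
    intro x hx f
    have hinv : IsLocalization.Away.lift (S := Localization.Away Z) Z (hunit x hx)
        (IsLocalization.Away.invSelf Z) =
        (MvPolynomial.eval x Z)⁻¹ := by
      have h1 := congrArg (IsLocalization.Away.lift (S := Localization.Away Z) Z (hunit x hx))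
        (IsLocalization.Away.mul_invSelf (S := Localization.Away Z) Z)
      rw [map_mul, IsLocalization.Away.lift_eq, map_one] at h1
      exact eq_inv_of_mul_eq_one_right h1
    induction f using MvPolynomial.induction_on with
    | C a =>
      have : Φ (MvPolynomial.C a) = algebraMap (MvPolynomial σ ℝ) _ (MvPolynomial.C a) := by
        rw [show Φ (MvPolynomial.C a) = algebraMap ℝ _ a from MvPolynomial.aeval_C _ _]
        rw [IsScalarTower.algebraMap_apply ℝ (MvPolynomial σ ℝ)]
        rfl
      rw [this, IsLocalization.Away.lift_eq]
      simp
    | add p q hp hq => rw [map_add, map_add, hp, hq, map_add]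
    | mul_X p v hp =>
      rw [map_mul, map_mul, hp, map_mul]
      congr 1
      rw [show Φ (MvPolynomial.X v) = _ from MvPolynomial.aeval_X _ _, map_mul,
        IsLocalization.Away.lift_eq, hinv, MvPolynomial.eval_X, div_eq_mul_inv]
  have hker : ∀ f, Φ f = 0 ↔ f ∈ MvPolynomial.vanishingIdeal ℝ (rationalImage g Z) := by
    intro f
    rw [MvPolynomial.mem_vanishingIdeal_iff]
    constructor
    · rintro hf _ ⟨x, hx, rfl⟩
      have := heval x hx f
      rw [hf, map_zero] at this
      rw [MvPolynomial.aeval_eq_eval]; exact this.symm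
    · intro hf
      obtain ⟨n, a, ha⟩ := IsLocalization.Away.surj Z (Φ f)
      have ha0 : a = 0 := by
        apply MvPolynomial.eq_zero_of_eval_pos_eq_zero
        intro x hx
        have h1 := congrArg (IsLocalization.Away.lift Z (hunit x hx)) ha
        rw [map_mul, heval x hx, IsLocalization.Away.lift_eq] at h1
        have h2 := hf _ ⟨x, hx, rfl⟩
        rw [MvPolynomial.aeval_eq_eval] at h2
        rw [← h1]
        erw [h2]
        rw [zero_mul]
      rw [ha0, map_zero] at ha
      have hu : IsUnit (algebraMap _ (Localization.Away Z) Z ^ n) :=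
        (IsLocalization.Away.algebraMap_isUnit Z).pow n
      exact hu.mul_left_eq_zero.1 ha
  refine ⟨Ideal.Quotient.liftₐ _ Φ fun f hf => (hker f).2 hf, ?_⟩
  rw [injective_iff_map_eq_zero]
  intro y
  obtain ⟨f, rfl⟩ := Ideal.Quotient.mk_surjective y
  intro hy
  exact Ideal.Quotient.eq_zero_iff_mem.2 ((hker f).1 hy)

theorem isDomain_coordinateRing {ι σ : Type*} (g : ι → MvPolynomial σ ℝ)
    (Z : MvPolynomial σ ℝ) (hZ : ∀ x : σ → ℝ, (∀ i, 0 < x i) → 0 < MvPolynomial.eval x Z) :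
    IsDomain (MvPolynomial ι ℝ ⧸ MvPolynomial.vanishingIdeal ℝ (rationalImage g Z)) := by
  have hZ0 : Z ≠ 0 := by
    rintro rfl
    simpa using hZ (fun _ => 1) (fun _ => one_pos)
  have : IsDomain (Localization.Away Z) :=
    IsLocalization.isDomain_localization (powers_le_nonZeroDivisors_of_noZeroDivisors hZ0)
  obtain ⟨φ, hφ⟩ := exists_injective_algHom_coordinateRing g Z hZ
  exact hφ.isDomain φ.toRingHom

theorem semialgebraicDim_rationalImage_le {ι σ : Type} [Finite ι] [Finite σ]
    (g : ι → MvPolynomial σ ℝ) (Z : MvPolynomial σ ℝ)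
    (hZ : ∀ x : σ → ℝ, (∀ i, 0 < x i) → 0 < MvPolynomial.eval x Z) :
    semialgebraicDim (rationalImage g Z) ≤ (Nat.card σ : WithBot ℕ∞) := by
  have hZ0 : Z ≠ 0 := by
    rintro rfl
    simpa using hZ (fun _ => 1) (fun _ => one_pos)
  have := isDomain_coordinateRing g Z hZ
  obtain ⟨φ, hφ⟩ := exists_injective_algHom_coordinateRing g Z hZ
  obtain ⟨s, h1, h2⟩ := ringKrullDim_eq_trdeg ℝ
    (MvPolynomial ι ℝ ⧸ MvPolynomial.vanishingIdeal ℝ (rationalImage g Z))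
  have h3 := trdeg_le_of_injective φ hφ
  rw [h2, trdeg_localizationAway Z hZ0, Nat.cast_le] at h3
  rw [semialgebraicDim, h1]
  exact_mod_cast h3

/-- If a linear projection of `S` to `ℝ^m` has interior points, then `m ≤ dim S`. -/
theorem le_semialgebraicDim_of_interior_image {ι : Type} [Fintype ι] (S : Set (ι → ℝ))
    [IsDomain (MvPolynomial ι ℝ ⧸ MvPolynomial.vanishingIdeal ℝ S)] {m : ℕ}
    (π : (ι → ℝ) →ₗ[ℝ] (Fin m → ℝ)) (hS : (interior (π '' S)).Nonempty) :
    (m : WithBot ℕ∞) ≤ semialgebraicDim S := by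
  classical
  let ψ : MvPolynomial (Fin m) ℝ →ₐ[ℝ] MvPolynomial ι ℝ :=
    MvPolynomial.aeval fun i => ∑ v, MvPolynomial.C (π (Pi.single v 1) i) * MvPolynomial.X v
  have hψ : ∀ (x : ι → ℝ) f, MvPolynomial.eval x (ψ f) = MvPolynomial.eval (π x) f := by
    intro x f
    have hx : ∀ i, π x i = ∑ v, π (Pi.single v 1) i * x v := by
      intro i
      conv_lhs => rw [pi_eq_sum_univ' x, map_sum]
      simp only [Finset.sum_apply, map_smul, Pi.smul_apply, smul_eq_mul]
      refine Finset.sum_congr rfl fun v _ => ?_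
      rw [mul_comm]
    have : (MvPolynomial.eval x).comp ψ.toRingHom = MvPolynomial.eval (π x) := by
      apply MvPolynomial.ringHom_ext
      · intro r; simp [ψ]
      · intro i; simp [ψ, hx]
    exact congrArg (fun F => F f) this
  let Ψ := (Ideal.Quotient.mkₐ ℝ (MvPolynomial.vanishingIdeal ℝ S)).comp ψ
  -- A polynomial whose pullback along `π` vanishes on `S` vanishes on a ball, so it is zero: the
  -- `m` coordinates of `π` are algebraically independent on `S`.
  have hinj : Function.Injective Ψ := by
    rw [injective_iff_map_eq_zero]
    intro f hf
    have hf' : ψ f ∈ MvPolynomial.vanishingIdeal ℝ S := Ideal.Quotient.eq_zero_iff_mem.1 hf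
    rw [MvPolynomial.mem_vanishingIdeal_iff] at hf'
    obtain ⟨y, hy⟩ := hS
    obtain ⟨ε, hε, hball⟩ := Metric.isOpen_iff.1 isOpen_interior y hy
    refine MvPolynomial.funext_set (fun i => Metric.ball (y i) ε) (fun i => ?_) fun z hz => ?_
    · rw [Real.ball_eq_Ioo]
      exact Set.Ioo_infinite (by linarith)
    · have hz' : z ∈ Metric.ball y ε := by
        rw [ball_pi _ hε]; exact hz
      obtain ⟨x, hxS, hx⟩ := interior_subset (hball hz')
      have := hf' x hxS
      rw [MvPolynomial.aeval_eq_eval] at this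
      rw [map_zero, ← hx, ← hψ]
      exact this
  obtain ⟨s, h1, h2⟩ := ringKrullDim_eq_trdeg ℝ
    (MvPolynomial ι ℝ ⧸ MvPolynomial.vanishingIdeal ℝ S)
  have h3 := trdeg_le_of_injective Ψ hinj
  rw [h2, MvPolynomial.trdeg_of_isDomain] at h3
  have h4 : m ≤ s := by simpa using h3
  rw [semialgebraicDim, h1]
  exact_mod_cast h4

/-- The equation of the hyperplane is a non-zero-divisor in the vanishing ideal, and dividing by it
costs one dimension. -/
theorem semialgebraicDim_add_one_le_card {ι : Type} [Fintype ι] (S : Set (ι → ℝ))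
    (hS : S ⊆ openSimplex ι) : semialgebraicDim S + 1 ≤ (Fintype.card ι : WithBot ℕ∞) := by
  let f : MvPolynomial ι ℝ := ∑ i, MvPolynomial.X i - 1
  have hf : f ≠ 0 := by
    intro h
    have := congrArg (MvPolynomial.eval 0) h
    simp [f] at this
  have hle : Ideal.span {f} ≤ MvPolynomial.vanishingIdeal ℝ S := by
    rw [Ideal.span_singleton_le_iff_mem, MvPolynomial.mem_vanishingIdeal_iff]
    intro x hx
    simp [f, (hS hx).2]
  have h1 := ringKrullDim_le_of_surjective (Ideal.Quotient.factor hle)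
    (Ideal.Quotient.factor_surjective hle)
  have h2 := ringKrullDim_quotient_succ_le_of_nonZeroDivisor (mem_nonZeroDivisors_of_ne_zero hf)
  have h3 : ringKrullDim (MvPolynomial ι ℝ) = (Fintype.card ι : WithBot ℕ∞) := by simp
  rw [h3] at h2
  refine le_trans ?_ h2
  gcongr
  exact h1

/-! ### Matching the sign diagrams of two families of univariate polynomials. -/

open Polynomial in
/-- All polynomials of the family `p` have constant sign on the segment between `y` and `z`. -/
def SameCell {I : Type*} (p : I → ℝ[X]) (y z : ℝ) : Prop :=
  ∀ w ∈ Set.uIcc y z, ∀ i, SignType.sign ((p i).eval w) = SignType.sign ((p i).eval y)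

namespace SameCell

open Polynomial

variable {I : Type*} {p : I → ℝ[X]} {a b c d : ℝ}

theorem refl (a : ℝ) : SameCell p a a := fun w hw i => by
  rw [Set.uIcc_self, Set.mem_singleton_iff] at hw; rw [hw]

theorem sign_eq (h : SameCell p a b) (i : I) :
    SignType.sign ((p i).eval a) = SignType.sign ((p i).eval b) :=
  (h b Set.right_mem_uIcc i).symm

theorem symm (h : SameCell p a b) : SameCell p b a := fun w hw i => by
  rw [h w (Set.uIcc_comm a b ▸ hw) i, h.sign_eq i]

theorem trans (h : SameCell p a b) (h' : SameCell p b c) : SameCell p a c := fun w hw i => by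
  rcases Set.uIcc_subset_uIcc_union_uIcc (b := b) hw with hw | hw
  · exact h w hw i
  · rw [h' w hw i, h.sign_eq i]

theorem mono (h : SameCell p a b) (hc : c ∈ Set.uIcc a b) : SameCell p a c := fun w hw i =>
  h w (Set.uIcc_subset_uIcc_left hc hw) i

theorem of_overlap (h : SameCell p a b) (h' : SameCell p c d) (hac : a ≤ c) (hdb : d ≤ b) :
    SameCell p a c := by
  rcases le_total c b with hcb | hbc
  · exact h.mono (Set.mem_uIcc.2 (Or.inl ⟨hac, hcb⟩))
  · exact h.trans (h'.mono (Set.mem_uIcc.2 (Or.inr ⟨hdb, hbc⟩))).symm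

theorem of_forall_ne_zero (h : ∀ t ∈ Set.uIcc a b, ∀ i, p i ≠ 0 → (p i).eval t ≠ 0) :
    SameCell p a b := by
  intro w hw i
  by_cases hi : p i = 0
  · simp [hi]
  by_contra hne
  have hcont : ContinuousOn (fun t => (p i).eval t) (Set.uIcc a w) :=
    (p i).continuous.continuousOn
  have hsub : Set.uIcc a w ⊆ Set.uIcc a b := Set.uIcc_subset_uIcc_left hw
  have h0 : (0 : ℝ) ∈ Set.uIcc ((p i).eval a) ((p i).eval w) := by
    have ha := h a Set.left_mem_uIcc i hi
    have hw' := h w hw i hi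
    rw [Set.mem_uIcc]
    rcases lt_or_gt_of_ne ha with ha | ha <;> rcases lt_or_gt_of_ne hw' with hw' | hw'
    · exact absurd (by rw [sign_neg ha, sign_neg hw']) hne
    · exact Or.inl ⟨ha.le, hw'.le⟩
    · exact Or.inr ⟨hw'.le, ha.le⟩
    · exact absurd (by rw [sign_pos ha, sign_pos hw']) hne
  obtain ⟨t, ht, ht0⟩ := intermediate_value_uIcc hcont h0
  exact h t (hsub ht) i hi ht0

theorem eq_of_eval_eq_zero (h : SameCell p a b) {i : I} (hi : p i ≠ 0) (ha : (p i).eval a = 0) :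
    a = b := by
  by_contra hab
  apply hi
  apply Polynomial.eq_zero_of_infinite_isRoot
  refine Set.Infinite.mono ?_ (Set.Icc_infinite (inf_lt_sup.2 hab))
  intro t ht
  have := h t ht i
  rw [ha, sign_zero, sign_eq_zero_iff] at this
  exact this

end SameCell

open Polynomial in
/-- A correspondence between two real lines that respects the order and the signs of the
polynomials `p i` on the first line and `q i` on the second one. -/
structure SignMatch {I : Type*} (p q : I → ℝ[X]) (R : ℝ → ℝ → Prop) : Prop where
  left : ∀ y, ∃ y', R y y'
  right : ∀ y', ∃ y, R y y'
  sign : ∀ {y y'}, R y y' → ∀ i, SignType.sign ((p i).eval y) = SignType.sign ((q i).eval y')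
  -- Matched pairs may occur in reversed order only inside one cell on each line. With `y = z` this
  -- puts all partners of a point in one cell.
  order : ∀ {y y' z z'}, R y y' → R z z' → y ≤ z → z' ≤ y' → SameCell p y z ∧ SameCell q y' z'

namespace SignMatch

open Polynomial

variable {I J : Type*} {p q : I → ℝ[X]} {R : ℝ → ℝ → Prop}

theorem flip (h : SignMatch p q R) : SignMatch q p (fun y' y => R y y') where
  left := h.right
  right := h.left
  sign hr i := (h.sign hr i).symm
  order hr hs h1 h2 := by
    obtain ⟨h3, h4⟩ := h.order hs hr h2 h1
    exact ⟨h4.symm, h3.symm⟩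

theorem of_forall_exists (h : SignMatch p q R) {p' q' : J → ℝ[X]}
    (hj : ∀ j, ∃ i, p' j = p i ∧ q' j = q i) : SignMatch p' q' R where
  left := h.left
  right := h.right
  sign hr j := by
    obtain ⟨i, h1, h2⟩ := hj j
    rw [h1, h2]; exact h.sign hr i
  order hr hs h1 h2 := by
    obtain ⟨h3, h4⟩ := h.order hr hs h1 h2
    refine ⟨fun w hw j => ?_, fun w hw j => ?_⟩ <;> obtain ⟨i, h5, h6⟩ := hj j
    · rw [h5]; exact h3 w hw i
    · rw [h6]; exact h4 w hw i

theorem sameCell_comp_neg {a b : ℝ} :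
    SameCell (fun i => (p i).comp (-X)) a b ↔ SameCell p (-a) (-b) := by
  constructor
  · intro h w hw i
    have := h (-w) (by
      rw [Set.mem_uIcc] at hw ⊢
      rcases hw with hw | hw
      · right; constructor <;> linarith
      · left; constructor <;> linarith) i
    simpa using this
  · intro h w hw i
    have := h (-w) (by
      rw [Set.mem_uIcc] at hw ⊢
      rcases hw with hw | hw
      · right; constructor <;> linarith
      · left; constructor <;> linarith) i
    simpa using this

theorem comp_neg (h : SignMatch p q R) :
    SignMatch (fun i => (p i).comp (-X)) (fun i => (q i).comp (-X)) (fun y y' => R (-y) (-y')) where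
  left y := by
    obtain ⟨y', hy⟩ := h.left (-y)
    exact ⟨-y', by simpa using hy⟩
  right y' := by
    obtain ⟨y, hy⟩ := h.right (-y')
    exact ⟨-y, by simpa using hy⟩
  sign hr i := by simpa using h.sign hr i
  order hr hs h1 h2 := by
    obtain ⟨h3, h4⟩ := h.order hs hr (neg_le_neg h1) (neg_le_neg h2)
    exact ⟨sameCell_comp_neg.2 h3.symm, sameCell_comp_neg.2 h4.symm⟩

/-- A point `c'` between `w'` and `u'` with another sign has a partner `c` outside the segment from
`w` to `u`. Then `c` lies on one side of both ends, and `order` puts `c'` on one side of both `w'`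
and `u'`. -/
theorem sameCell_right (h : SignMatch p q R) {w w' u u' : ℝ} (hw : R w w') (hu : R u u')
    (hc : SameCell p w u) : SameCell q w' u' := by
  intro c' hc' i
  by_contra hne
  obtain ⟨c, hcc⟩ := h.right c'
  have hsw : SignType.sign ((p i).eval c) ≠ SignType.sign ((p i).eval w) := by
    rwa [h.sign hcc i, h.sign hw i]
  have hsu : SignType.sign ((p i).eval c) ≠ SignType.sign ((p i).eval u) := by
    rwa [← hc.sign_eq i]
  have hcn : c ∉ Set.uIcc w u := fun hmem => hsw (hc c hmem i)
  have key : ∀ {v v'}, R v v' → SignType.sign ((p i).eval c) ≠ SignType.sign ((p i).eval v) →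
      (c ≤ v → c' < v') ∧ (v ≤ c → v' < c') := by
    intro v v' hv hsv
    constructor
    · intro hle
      by_contra hlt
      exact hsv ((h.order hcc hv hle (not_lt.1 hlt)).1.sign_eq i)
    · intro hle
      by_contra hlt
      exact hsv ((h.order hv hcc hle (not_lt.1 hlt)).1.sign_eq i).symm
  have kw := key hw hsw
  have ku := key hu hsu
  rw [Set.mem_uIcc] at hcn hc'
  push Not at hcn
  rcases le_total c w with h1 | h1
  · have h2 := kw.1 h1
    rcases le_total c u with h3 | h3
    · have h4 := ku.1 h3
      rcases hc' with h5 | h5 <;> linarith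
    · exact absurd (hcn.2 h3) (not_lt.2 h1)
  · have h2 := kw.2 h1
    rcases le_total c u with h3 | h3
    · exact absurd (hcn.1 h1) (not_lt.2 h3)
    · have h4 := ku.2 h3
      rcases hc' with h5 | h5 <;> linarith

theorem sameCell_left (h : SignMatch p q R) {w w' u u' : ℝ} (hw : R w w') (hu : R u u')
    (hc : SameCell q w' u') : SameCell p w u := h.flip.sameCell_right hw hu hc

/-- The saturation of a correspondence with respect to cells. -/
def closure (p q : I → ℝ[X]) (R : ℝ → ℝ → Prop) (y y' : ℝ) : Prop :=
  ∃ w w', R w w' ∧ SameCell p w y ∧ SameCell q w' y'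

/-- Saturation lets a partner be moved freely inside its cell, as refinement by a new polynomial
requires. Unless two base pairs are already reversed, a reversal of the moved points makes cells
overlap on one line, so the base points there share a cell, and then so do their partners. -/
theorem closure_match (h : SignMatch p q R) : SignMatch p q (closure p q R) where
  left y := by
    obtain ⟨y', hy⟩ := h.left y
    exact ⟨y', y, y', hy, SameCell.refl _, SameCell.refl _⟩
  right y' := by
    obtain ⟨y, hy⟩ := h.right y'
    exact ⟨y, y, y', hy, SameCell.refl _, SameCell.refl _⟩
  sign := by
    rintro y y' ⟨w, w', hw, h1, h2⟩ i
    rw [← h1.sign_eq i, ← h2.sign_eq i, h.sign hw i]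
  order := by
    rintro y y' z z' ⟨w, w', hw, h1, h2⟩ ⟨u, u', hu, h3, h4⟩ hyz hzy
    suffices hs : SameCell p w u ∧ SameCell q w' u' from
      ⟨h1.symm.trans (hs.1.trans h3), h2.symm.trans (hs.2.trans h4)⟩
    rcases le_total w u with hle | hle
    · rcases le_total u' w' with hle' | hle'
      · exact h.order hw hu hle hle'
      · have := h2.of_overlap h4 hle' hzy
        exact ⟨h.sameCell_left hw hu this, this⟩
    · have := (h3.of_overlap h1 hle hyz).symm
      exact ⟨this, h.sameCell_right hw hu this⟩

theorem closure_right {y y' z' : ℝ} (h : closure p q R y y') (hc : SameCell q y' z') :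
    closure p q R y z' := by
  obtain ⟨w, w', hw, h1, h2⟩ := h
  exact ⟨w, w', hw, h1, h2.trans hc⟩

theorem closure_left {y y' z : ℝ} (h : closure p q R y y') (hc : SameCell p y z) :
    closure p q R z y' := by
  obtain ⟨w, w', hw, h1, h2⟩ := h
  exact ⟨w, w', hw, h1.trans hc, h2⟩

theorem ne_zero_left (h : SignMatch p q R) {i : I} (hi : q i ≠ 0) : p i ≠ 0 := by
  intro h0
  apply hi
  apply Polynomial.funext
  intro y'
  obtain ⟨y, hy⟩ := h.right y'
  have := h.sign hy i
  rw [h0, eval_zero, sign_zero, eq_comm, sign_eq_zero_iff] at this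
  simpa using this

theorem ne_zero_right (h : SignMatch p q R) {i : I} (hi : p i ≠ 0) : q i ≠ 0 :=
  h.flip.ne_zero_left hi

end SignMatch

/-! ### Refining a correspondence by a polynomial whose derivative is in the family. -/

section

open Polynomial

/-- A polynomial whose derivative does not vanish on a segment and is positive at its right end is
strictly increasing on it. -/
theorem Polynomial.strictMonoOn_Icc_of_derivative_ne_zero {f : ℝ[X]} {a y : ℝ}
    (h : ∀ t ∈ Set.Ioc a y, (derivative f).eval t ≠ 0) (hy : 0 < (derivative f).eval y) :
    StrictMonoOn (fun t => f.eval t) (Set.Icc a y) := by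
  refine strictMonoOn_of_deriv_pos (convex_Icc a y) f.continuous.continuousOn fun t ht => ?_
  rw [interior_Icc] at ht
  rw [Polynomial.deriv]
  by_contra hneg
  obtain ⟨s, hs, hs0⟩ := intermediate_value_Icc ht.2.le
    (derivative f).continuous.continuousOn (Set.mem_Icc.2 ⟨not_lt.1 hneg, hy.le⟩)
  exact h s ⟨lt_of_lt_of_le ht.1 hs.1, hs.2⟩ hs0

/-- To the left of `y` the polynomial is bounded above by its value at `y`, and a nonconstant
polynomial is unbounded in absolute value, so it must become negative. -/
theorem Polynomial.exists_eval_neg_of_derivative_pos {g : ℝ[X]} {y : ℝ}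
    (h : ∀ t ≤ y, (derivative g).eval t ≠ 0) (hy : 0 < (derivative g).eval y) :
    ∃ w ≤ y, g.eval w < 0 := by
  have hdeg : 0 < (g.comp (-X)).degree := by
    rw [← natDegree_pos_iff_degree_pos, natDegree_comp, natDegree_neg, natDegree_X, mul_one]
    by_contra hd
    have : derivative g = 0 := derivative_of_natDegree_zero (by omega)
    simp [this] at hy
  have ht := (Polynomial.abs_tendsto_atTop (g.comp (-X)) hdeg).eventually
    (Filter.eventually_gt_atTop |g.eval y|)
  obtain ⟨s, hs1, hs2⟩ := (ht.and (Filter.eventually_ge_atTop (-y))).exists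
  have hsy : -s ≤ y := by linarith
  have hle : g.eval (-s) ≤ g.eval y :=
    (strictMonoOn_Icc_of_derivative_ne_zero (a := -s) (fun t ht => h t ht.2) hy).monotoneOn
      ⟨le_rfl, hsy⟩ ⟨hsy, le_rfl⟩ hsy
  refine ⟨-s, hsy, ?_⟩
  simp only [eval_comp, eval_neg, eval_X] at hs1
  by_contra hneg
  rw [abs_of_nonneg (not_lt.1 hneg)] at hs1
  linarith [le_abs_self (g.eval y)]

namespace SignMatch

variable {I J : Type*} {p q : I → ℝ[X]} {R : ℝ → ℝ → Prop}

/-- The partner is moved to the left inside its cell until `g` has the sign of `f` at `y`. If the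
cell reaches `-∞`, then `g` becomes negative there. Otherwise it ends at a zero `a'` of the family,
whose partner `a` has f(a) < f(y) ≤ 0; `h0` carries this sign over to g(a'). -/
theorem exists_sign_eq_of_increasing [Finite I] (h : SignMatch p q R)
    (hR : ∀ {y y' z'}, R y y' → SameCell q y' z' → R y z') {i₀ : I} (hi₀ : p i₀ ≠ 0) {f g : ℝ[X]}
    (hf : ∀ t, (derivative f).eval t = 0 → (p i₀).eval t = 0)
    (hg : ∀ t, (derivative g).eval t = 0 → (q i₀).eval t = 0)
    (h0 : ∀ {y y'}, R y y' → (∃ i, p i ≠ 0 ∧ (p i).eval y = 0) →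
      SignType.sign (f.eval y) = SignType.sign (g.eval y'))
    {y y₀ : ℝ} (hr : R y y₀) (hy : ∀ i, p i ≠ 0 → (p i).eval y ≠ 0)
    (hfy : 0 < (derivative f).eval y) (hgy : 0 < (derivative g).eval y₀)
    (hf0 : f.eval y ≤ 0) (hg0 : 0 ≤ g.eval y₀) :
    ∃ y', R y y' ∧ SignType.sign (f.eval y) = SignType.sign (g.eval y') := by
  have hy' : ∀ i, q i ≠ 0 → (q i).eval y₀ ≠ 0 := by
    intro i hi h1
    have := h.sign hr i
    rw [h1, sign_zero, sign_eq_zero_iff] at this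
    exact hy i (h.ne_zero_left hi) this
  suffices hclaim : ∃ w' ≤ y₀, SameCell q y₀ w' ∧ g.eval w' < 0 by
    obtain ⟨w', hw, hc, hneg⟩ := hclaim
    rcases hf0.lt_or_eq with hlt | heq
    · exact ⟨w', hR hr hc, by rw [sign_neg hlt, sign_neg hneg]⟩
    · obtain ⟨t, ht, ht0⟩ := intermediate_value_Icc hw g.continuous.continuousOn
        (Set.mem_Icc.2 ⟨hneg.le, hg0⟩)
      refine ⟨t, hR hr (hc.mono (Set.mem_uIcc.2 (Or.inr ⟨ht.1, ht.2⟩))), ?_⟩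
      rw [heq]; simp only at ht0; rw [ht0]
  let N : Set ℝ := {t | ∃ i, q i ≠ 0 ∧ (q i).eval t = 0}
  have hN : N.Finite := by
    have : N ⊆ ⋃ i, {t | q i ≠ 0 ∧ (q i).eval t = 0} := by
      rintro t ⟨i, hi⟩; exact Set.mem_iUnion.2 ⟨i, hi⟩
    refine (Set.finite_iUnion fun i => ?_).subset this
    by_cases hi : q i = 0
    · simp [hi]
    · exact (Polynomial.finite_setOfPred_isRoot hi).subset fun t ht => ht.2
  have hqi₀ := h.ne_zero_right hi₀
  by_cases hex : (N ∩ Set.Iio y₀).Nonempty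
  · obtain ⟨a', ⟨⟨i, hi, hia⟩, hay'⟩, hmax⟩ :=
      Set.exists_max_image _ id (hN.inter_of_left _) hex
    have hay : a' < y₀ := hay'
    have hno : ∀ t ∈ Set.Ioc a' y₀, t ∉ N := by
      rintro t ⟨ht1, ht2⟩ htN
      rcases ht2.lt_or_eq with hlt | rfl
      · exact absurd (hmax t ⟨htN, hlt⟩) (not_le.2 ht1)
      · obtain ⟨j, hj, hj0⟩ := htN
        exact hy' j hj hj0
    obtain ⟨a, haa⟩ := h.right a'
    have hpi := h.ne_zero_left hi
    have hroot : ∀ {c c' j}, R c c' → q j ≠ 0 → (q j).eval c' = 0 → (p j).eval c = 0 := by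
      intro c c' j hc hj h1
      have := h.sign hc j
      rwa [h1, sign_zero, sign_eq_zero_iff] at this
    have hpa : (p i).eval a = 0 := hroot haa hi hia
    have hlt : a < y := by
      by_contra hle
      have h1 := (h.order hr haa (not_lt.1 hle) hay.le).1
      have := h1.symm.eq_of_eval_eq_zero hpi hpa
      exact hy i hpi (this ▸ hpa)
    -- A zero in `(a, y]` would have its partner outside `(a', y₀]`; the resulting reversal would
    -- put two distinct points, one of them a zero, in one cell.
    have hnoL : ∀ t ∈ Set.Ioc a y, ∀ j, p j ≠ 0 → (p j).eval t ≠ 0 := by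
      rintro c ⟨hc1, hc2⟩ j hj hj0
      obtain ⟨c', hc⟩ := h.left c
      have hqj := h.ne_zero_right hj
      have hcj : (q j).eval c' = 0 := by
        have := h.sign hc j
        rwa [hj0, sign_zero, eq_comm, sign_eq_zero_iff] at this
      have hcN : c' ∉ Set.Ioc a' y₀ := fun hmem => hno c' hmem ⟨j, hqj, hcj⟩
      rcases le_or_gt c' a' with h1 | h1
      · have := (h.order haa hc hc1.le h1).1.eq_of_eval_eq_zero hpi hpa
        exact hc1.ne this
      · have h2 : y₀ ≤ c' := by
          by_contra h3
          exact hcN ⟨h1, (not_le.1 h3).le⟩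
        have := (h.order hc hr hc2 h2).1.eq_of_eval_eq_zero hj hj0
        exact hy j hj (this ▸ hj0)
    have hmono := strictMonoOn_Icc_of_derivative_ne_zero
      (fun t ht hz => hnoL t ht i₀ hi₀ (hf t hz)) hfy
    have hfa : f.eval a < 0 :=
      lt_of_lt_of_le (hmono ⟨le_rfl, hlt.le⟩ ⟨hlt.le, le_rfl⟩ hlt) hf0
    have hga : g.eval a' < 0 := by
      have := h0 haa ⟨i, hpi, hpa⟩
      rwa [sign_neg hfa, eq_comm, sign_eq_neg_one_iff] at this
    have hev : ∀ᶠ t in nhdsWithin a' (Set.Ioi a'), g.eval t < 0 :=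
      (g.continuous.continuousAt.eventually_lt continuousAt_const hga).filter_mono
        nhdsWithin_le_nhds
    obtain ⟨w', hw1, hw2⟩ := (hev.and (Ioc_mem_nhdsGT hay)).exists
    refine ⟨w', hw2.2, SameCell.of_forall_ne_zero fun t ht j hj hj0 => ?_, hw1⟩
    rw [Set.uIcc_of_ge hw2.2] at ht
    exact hno t ⟨hw2.1.trans_le ht.1, ht.2⟩ ⟨j, hj, hj0⟩
  · have hno : ∀ t ≤ y₀, t ∉ N := by
      intro t ht htN
      rcases ht.lt_or_eq with hlt | rfl
      · exact hex ⟨t, htN, hlt⟩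
      · obtain ⟨j, hj, hj0⟩ := htN
        exact hy' j hj hj0
    obtain ⟨w', hw, hneg⟩ := exists_eval_neg_of_derivative_pos
      (fun t ht hz => hno t ht ⟨i₀, hqi₀, hg t hz⟩) hgy
    refine ⟨w', hw, SameCell.of_forall_ne_zero fun t ht j hj hj0 => ?_, hneg⟩
    rw [Set.uIcc_of_ge hw] at ht
    exact hno t ht.2 ⟨j, hj, hj0⟩

/-- At zeros of the family `h0` applies. Elsewhere the reflections t ↦ -t and f ↦ -f reduce any
disagreement of signs to increasing `f` and `g` with f(y) ≤ 0 ≤ g(y₀). -/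
theorem exists_sign_eq [Finite I] (h : SignMatch p q R)
    (hR : ∀ {y y' z'}, R y y' → SameCell q y' z' → R y z') {i₀ : I} {f g : ℝ[X]}
    (hf : p i₀ = derivative f) (hg : q i₀ = derivative g) (hf0 : derivative f ≠ 0)
    (h0 : ∀ {y y'}, R y y' → (∃ i, p i ≠ 0 ∧ (p i).eval y = 0) →
      SignType.sign (f.eval y) = SignType.sign (g.eval y')) (y : ℝ) :
    ∃ y', R y y' ∧ SignType.sign (f.eval y) = SignType.sign (g.eval y') := by
  obtain ⟨y₀, hr⟩ := h.left y
  by_cases hy : ∃ i, p i ≠ 0 ∧ (p i).eval y = 0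
  · exact ⟨y₀, hr, h0 hr hy⟩
  push Not at hy
  have hne : (derivative f).eval y ≠ 0 := hf ▸ hy i₀ (hf ▸ hf0)
  have hs := h.sign hr i₀
  rw [hf, hg] at hs
  by_cases hfg : (0 < f.eval y ∧ 0 < g.eval y₀) ∨ (f.eval y < 0 ∧ g.eval y₀ < 0)
  · refine ⟨y₀, hr, ?_⟩
    rcases hfg with ⟨h1, h2⟩ | ⟨h1, h2⟩
    · rw [sign_pos h1, sign_pos h2]
    · rw [sign_neg h1, sign_neg h2]
  have hcases : (f.eval y ≤ 0 ∧ 0 ≤ g.eval y₀) ∨ (0 ≤ f.eval y ∧ g.eval y₀ ≤ 0) := by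
    push Not at hfg
    rcases lt_trichotomy (f.eval y) 0 with h1 | h1 | h1
    · exact Or.inl ⟨h1.le, hfg.2 h1⟩
    · rcases le_total 0 (g.eval y₀) with h2 | h2
      · exact Or.inl ⟨h1.le, h2⟩
      · exact Or.inr ⟨h1.ge, h2⟩
    · exact Or.inr ⟨h1.le, hfg.1 h1⟩
  have hi₀ : p i₀ ≠ 0 := hf ▸ hf0
  have hRn : ∀ {y y' z'}, R (-y) (-y') → SameCell (fun i => (q i).comp (-X)) y' z' →
      R (-y) (-z') := fun hr hc => hR hr (sameCell_comp_neg.1 hc)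
  have hcomp : ∀ {F : ℝ[X]}, F.comp (-X) = 0 → F = 0 := by
    intro F hF
    have := congrArg (fun G => G.comp (-X)) hF
    simpa [comp_assoc] using this
  have hcomp' : ∀ {F : ℝ[X]}, F.comp (-X) ≠ 0 → F ≠ 0 := by
    rintro F hF rfl; simp at hF
  rcases lt_or_gt_of_ne hne with hd | hd
  · have hd' : (derivative g).eval y₀ < 0 := by
      rwa [sign_neg hd, eq_comm, sign_eq_neg_one_iff] at hs
    rcases hcases with ⟨h1, h2⟩ | ⟨h1, h2⟩
    · obtain ⟨y', h3, h4⟩ := h.comp_neg.exists_sign_eq_of_increasing (i₀ := i₀) (f := f.comp (-X))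
        (g := g.comp (-X)) (y := -y) (y₀ := -y₀) hRn (fun hz => hi₀ (hcomp hz))
        (by intro t; simp [hf, derivative_comp]) (by intro t; simp [hg, derivative_comp])
        (by
          rintro a a' ha ⟨i, hi, hi'⟩
          simpa using h0 ha ⟨i, hcomp' hi, by simpa using hi'⟩)
        (by simpa using hr) (by intro i hi; simpa using hy i (hcomp' hi))
        (by simpa [derivative_comp] using hd) (by simpa [derivative_comp] using hd')
        (by simpa using h1) (by simpa using h2)
      exact ⟨-y', by simpa using h3, by simpa using h4⟩
    · obtain ⟨y', h3, h4⟩ := h.exists_sign_eq_of_increasing (i₀ := i₀) (f := -f) (g := -g) hR hi₀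
        (by intro t; simp [hf]) (by intro t; simp [hg])
        (by
          intro a a' ha hi
          simpa [Left.sign_neg] using h0 ha hi)
        hr hy (by simpa using hd) (by simpa using hd') (by simpa using h1) (by simpa using h2)
      exact ⟨y', h3, by simpa [Left.sign_neg] using h4⟩
  · have hd' : 0 < (derivative g).eval y₀ := by
      rwa [sign_pos hd, eq_comm, sign_eq_one_iff] at hs
    rcases hcases with ⟨h1, h2⟩ | ⟨h1, h2⟩
    · exact h.exists_sign_eq_of_increasing hR hi₀ (by rw [hf]; exact fun _ => id)
        (by rw [hg]; exact fun _ => id) h0 hr hy hd hd' h1 h2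
    · obtain ⟨y', h3, h4⟩ := h.comp_neg.exists_sign_eq_of_increasing (i₀ := i₀)
        (f := -f.comp (-X)) (g := -g.comp (-X)) (y := -y) (y₀ := -y₀) hRn
        (fun hz => hi₀ (hcomp hz))
        (by intro t; simp [hf, derivative_comp]) (by intro t; simp [hg, derivative_comp])
        (by
          rintro a a' ha ⟨i, hi, hi'⟩
          simpa [Left.sign_neg] using h0 ha ⟨i, hcomp' hi, by simpa using hi'⟩)
        (by simpa using hr) (by intro i hi; simpa using hy i (hcomp' hi))
        (by simpa [derivative_comp] using hd) (by simpa [derivative_comp] using hd')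
        (by simpa using h1) (by simpa using h2)
      exact ⟨-y', by simpa using h3, by simpa [Left.sign_neg] using h4⟩

theorem monotoneOn_or_antitoneOn_of_derivative {f : ℝ[X]} {a b : ℝ}
    (hd : ∀ w ∈ Set.Icc a b, SignType.sign ((derivative f).eval w) =
      SignType.sign ((derivative f).eval a)) :
    (0 ≤ (derivative f).eval a → MonotoneOn (fun t => f.eval t) (Set.Icc a b)) ∧
    ((derivative f).eval a ≤ 0 → AntitoneOn (fun t => f.eval t) (Set.Icc a b)) := by
  constructor
  · intro h
    refine monotoneOn_of_deriv_nonneg (convex_Icc a b) f.continuous.continuousOn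
      f.differentiable.differentiableOn fun t ht => ?_
    rw [Polynomial.deriv, ← sign_nonneg_iff, hd t (interior_subset ht)]
    exact sign_nonneg_iff.2 h
  · intro h
    refine antitoneOn_of_deriv_nonpos (convex_Icc a b) f.continuous.continuousOn
      f.differentiable.differentiableOn fun t ht => ?_
    rw [Polynomial.deriv, ← sign_nonpos_iff, hd t (interior_subset ht)]
    exact sign_nonpos_iff.2 h

theorem sign_const_of_monotoneOn {f : ℝ → ℝ} {a b : ℝ}
    (hf : MonotoneOn f (Set.Icc a b) ∨ AntitoneOn f (Set.Icc a b))
    (h : SignType.sign (f a) = SignType.sign (f b)) {w : ℝ} (hw : w ∈ Set.Icc a b) :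
    SignType.sign (f w) = SignType.sign (f a) := by
  have hab : a ≤ b := hw.1.trans hw.2
  rcases hf with hf | hf
  · have h1 := SignType.sign.monotone (hf ⟨le_rfl, hab⟩ hw hw.1)
    have h2 := SignType.sign.monotone (hf hw ⟨hab, le_rfl⟩ hw.2)
    exact le_antisymm (h ▸ h2) h1
  · have h1 := SignType.sign.monotone (hf ⟨le_rfl, hab⟩ hw hw.1)
    have h2 := SignType.sign.monotone (hf hw ⟨hab, le_rfl⟩ hw.2)
    exact le_antisymm h1 (h ▸ h2)

/-- Both polynomials are monotone in the same direction, while the pairs are in opposite orders. In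
the increasing case, sign f(y) ≤ sign f(z) = sign g(z') ≤ sign g(y') = sign f(y), so all are equal.
-/
theorem sign_eq_of_order (h : SignMatch p q R) {i₀ : I} {f g : ℝ[X]}
    (hf : p i₀ = derivative f) (hg : q i₀ = derivative g) {y y' z z' : ℝ} (hy : R y y')
    (hz : R z z') (hyz : y ≤ z) (hzy : z' ≤ y')
    (hsy : SignType.sign (f.eval y) = SignType.sign (g.eval y'))
    (hsz : SignType.sign (f.eval z) = SignType.sign (g.eval z')) :
    (∀ w ∈ Set.uIcc y z, SignType.sign (f.eval w) = SignType.sign (f.eval y)) ∧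
    (∀ w ∈ Set.uIcc y' z', SignType.sign (g.eval w) = SignType.sign (g.eval y')) := by
  obtain ⟨h1, h2⟩ := h.order hy hz hyz hzy
  have hf' := monotoneOn_or_antitoneOn_of_derivative (f := f) (a := y) (b := z) (fun w hw => by
    have := h1 w (Set.uIcc_of_le hyz ▸ hw) i₀
    rwa [hf] at this)
  have hg' := monotoneOn_or_antitoneOn_of_derivative (f := g) (a := z') (b := y') (fun w hw => by
    have := h2.symm w (Set.uIcc_of_le hzy ▸ hw) i₀
    rwa [hg] at this)
  have hs : SignType.sign ((derivative f).eval y) = SignType.sign ((derivative g).eval z') := by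
    have h3 := h.sign hy i₀
    have h4 := h2.sign_eq i₀
    rw [hf, hg] at h3
    rw [hg] at h4
    rw [h3, h4]
  have key : SignType.sign (f.eval y) = SignType.sign (f.eval z) ∧
      SignType.sign (g.eval z') = SignType.sign (g.eval y') ∧
      (MonotoneOn (fun t => f.eval t) (Set.Icc y z) ∨
        AntitoneOn (fun t => f.eval t) (Set.Icc y z)) ∧
      (MonotoneOn (fun t => g.eval t) (Set.Icc z' y') ∨
        AntitoneOn (fun t => g.eval t) (Set.Icc z' y')) := by
    rcases le_total 0 ((derivative f).eval y) with hd | hd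
    · have hd' : 0 ≤ (derivative g).eval z' := by
        rw [← sign_nonneg_iff, ← hs]; exact sign_nonneg_iff.2 hd
      have m1 := SignType.sign.monotone (hf'.1 hd ⟨le_rfl, hyz⟩ ⟨hyz, le_rfl⟩ hyz)
      have m2 := SignType.sign.monotone (hg'.1 hd' ⟨le_rfl, hzy⟩ ⟨hzy, le_rfl⟩ hzy)
      simp only at m1 m2
      refine ⟨le_antisymm m1 ?_, le_antisymm m2 ?_, Or.inl (hf'.1 hd), Or.inl (hg'.1 hd')⟩
      · rw [hsy, hsz]; exact m2
      · rw [← hsy, ← hsz]; exact m1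
    · have hd' : (derivative g).eval z' ≤ 0 := by
        rw [← sign_nonpos_iff, ← hs]; exact sign_nonpos_iff.2 hd
      have m1 := SignType.sign.monotone (hf'.2 hd ⟨le_rfl, hyz⟩ ⟨hyz, le_rfl⟩ hyz)
      have m2 := SignType.sign.monotone (hg'.2 hd' ⟨le_rfl, hzy⟩ ⟨hzy, le_rfl⟩ hzy)
      simp only at m1 m2
      refine ⟨le_antisymm ?_ m1, le_antisymm ?_ m2, Or.inr (hf'.2 hd), Or.inr (hg'.2 hd')⟩
      · rw [hsy, hsz]; exact m2
      · rw [← hsy, ← hsz]; exact m1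
  obtain ⟨k1, k2, k3, k4⟩ := key
  constructor
  · intro w hw
    rw [Set.uIcc_of_le hyz] at hw
    exact sign_const_of_monotoneOn k3 k1 hw
  · intro w hw
    rw [Set.uIcc_of_ge hzy] at hw
    rw [sign_const_of_monotoneOn k4 k2 hw, k2]

/-- A correspondence for a family that contains `f'` and decides the sign of `f` at the zeros of the
family can be refined to one that respects the signs of `f` as well. -/
theorem refine_of_derivative [Finite I] (h : SignMatch p q R) {i₀ : I} {f g : ℝ[X]}
    (hf : p i₀ = derivative f) (hg : q i₀ = derivative g) (hf0 : derivative f ≠ 0)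
    (h0 : ∀ {y y'}, R y y' → (∃ i, p i ≠ 0 ∧ (p i).eval y = 0) →
      SignType.sign (f.eval y) = SignType.sign (g.eval y')) {p' q' : J → ℝ[X]}
    (hj : ∀ j, (∃ i, p' j = p i ∧ q' j = q i) ∨ (p' j = f ∧ q' j = g)) :
    SignMatch p' q' (fun y y' => closure p q R y y' ∧
      SignType.sign (f.eval y) = SignType.sign (g.eval y')) := by
  have hc := h.closure_match
  have h0c : ∀ {y y'}, closure p q R y y' → (∃ i, p i ≠ 0 ∧ (p i).eval y = 0) →
      SignType.sign (f.eval y) = SignType.sign (g.eval y') := by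
    rintro y y' ⟨w, w', hw, h1, h2⟩ ⟨i, hi, hi0⟩
    obtain rfl : y = w := h1.symm.eq_of_eval_eq_zero hi hi0
    have hi' := h.sign hw i
    rw [hi0, sign_zero, eq_comm, sign_eq_zero_iff] at hi'
    obtain rfl : w' = y' := h2.eq_of_eval_eq_zero (h.ne_zero_right hi) hi'
    exact h0 hw ⟨i, hi, hi0⟩
  have hg0 : derivative g ≠ 0 := hg ▸ h.ne_zero_right (hf ▸ hf0)
  refine ⟨hc.exists_sign_eq closure_right hf hg hf0 h0c, fun y' => ?_, ?_, ?_⟩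
  · obtain ⟨y, h1, h2⟩ := hc.flip.exists_sign_eq (fun {_ _ _} => closure_left) hg hf hg0
      (f := g) (g := f) (by
        rintro y y' hy ⟨i, hi, hi0⟩
        have hi' := hc.sign hy i
        rw [hi0, sign_zero, sign_eq_zero_iff] at hi'
        exact (h0c hy ⟨i, hc.ne_zero_left hi, hi'⟩).symm) y'
    exact ⟨y, h1, h2.symm⟩
  · rintro y y' ⟨h1, h2⟩ j
    rcases hj j with ⟨i, h3, h4⟩ | ⟨h3, h4⟩
    · rw [h3, h4]; exact hc.sign h1 i
    · rw [h3, h4]; exact h2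
  · rintro y y' z z' ⟨h1, h2⟩ ⟨h3, h4⟩ hyz hzy
    have h5 := hc.order h1 h3 hyz hzy
    have h6 := hc.sign_eq_of_order hf hg h1 h3 hyz hzy h2 h4
    refine ⟨fun w hw j => ?_, fun w hw j => ?_⟩ <;> rcases hj j with ⟨i, h7, h8⟩ | ⟨h7, h8⟩
    · rw [h7]; exact h5.1 w hw i
    · rw [h7]; exact h6.1 w hw
    · rw [h8]; exact h5.2 w hw i
    · rw [h8]; exact h6.2 w hw

/-- Adjoining a pair of constants of the same sign to a correspondence. -/
theorem adjoin_C (h : SignMatch p q R) {a b : ℝ} (hab : SignType.sign a = SignType.sign b)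
    {p' q' : J → ℝ[X]} (hj : ∀ j, (∃ i, p' j = p i ∧ q' j = q i) ∨ (p' j = C a ∧ q' j = C b)) :
    SignMatch p' q' R where
  left := h.left
  right := h.right
  sign hr j := by
    rcases hj j with ⟨i, h3, h4⟩ | ⟨h3, h4⟩
    · rw [h3, h4]; exact h.sign hr i
    · rw [h3, h4, eval_C, eval_C, hab]
  order hr hs h1 h2 := by
    have h5 := h.order hr hs h1 h2
    refine ⟨fun w hw j => ?_, fun w hw j => ?_⟩ <;> rcases hj j with ⟨i, h7, h8⟩ | ⟨h7, h8⟩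
    · rw [h7]; exact h5.1 w hw i
    · rw [h7, eval_C, eval_C]
    · rw [h8]; exact h5.2 w hw i
    · rw [h8, eval_C, eval_C]

end SignMatch

end

/-! ### Sign diagrams depending on parameters. -/

section

open Polynomial

section parametric

variable {A : Type*} [CommRing A]

/-- The ring homomorphisms `φ` and `φ'` give the same sign to the elements of `G`. -/
def SignAgree (G : Set A) (φ φ' : A →+* ℝ) : Prop :=
  ∀ g ∈ G, SignType.sign (φ g) = SignType.sign (φ' g)

theorem SignAgree.mono {G G' : Set A} {φ φ' : A →+* ℝ} (h : SignAgree G φ φ') (hG : G' ⊆ G) :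
    SignAgree G' φ φ' := fun g hg => h g (hG hg)

theorem SignAgree.eq_zero_iff {G : Set A} {φ φ' : A →+* ℝ} (h : SignAgree G φ φ') {g : A}
    (hg : g ∈ G) : φ g = 0 ↔ φ' g = 0 := by
  rw [← sign_eq_zero_iff, h g hg, sign_eq_zero_iff]

theorem Polynomial.map_eraseLead_of_leadingCoeff {B : Type*} [CommRing B] (φ : A →+* B) (f : A[X])
    (h : φ f.leadingCoeff = 0) : f.eraseLead.map φ = f.map φ := by
  conv_rhs => rw [← f.eraseLead_add_C_mul_X_pow, Polynomial.map_add, Polynomial.map_mul, map_C, h,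
    C_0, zero_mul, add_zero]

/-- Specialization may lower the degree. Leading terms are deleted one at a time and their
coefficients recorded in `G`; agreement on `G` makes `φ` and `φ'` stop at the same truncation. -/
theorem exists_truncations (p : A[X]) : ∃ (T : Set A[X]) (G : Set A), T.Finite ∧ G.Finite ∧
    (∀ t ∈ T, t.natDegree ≤ p.natDegree) ∧ ∀ φ φ' : A →+* ℝ, SignAgree G φ φ' → p.map φ ≠ 0 →
      ∃ t ∈ T, t.map φ = p.map φ ∧ t.map φ' = p.map φ' ∧ φ t.leadingCoeff ≠ 0 ∧
        φ' t.leadingCoeff ≠ 0 := by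
  induction hn : p.support.card using Nat.strong_induction_on generalizing p with
  | _ n ih =>
    by_cases hp : p = 0
    · exact ⟨∅, ∅, Set.finite_empty, Set.finite_empty, by simp, fun φ φ' _ h => by simp [hp] at h⟩
    obtain ⟨T, G, hT, hG, hdeg, h⟩ := ih _ (hn ▸ eraseLead_support_card_lt hp) p.eraseLead rfl
    refine ⟨insert p T, insert p.leadingCoeff G, hT.insert p, hG.insert _, ?_, ?_⟩
    · rintro t (rfl | ht)
      · exact le_rfl
      · exact (hdeg t ht).trans (p.eraseLead_natDegree_le_aux)
    · intro φ φ' hag hne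
      have hz := hag.eq_zero_iff (Set.mem_insert p.leadingCoeff G)
      by_cases h0 : φ p.leadingCoeff = 0
      · have e1 := Polynomial.map_eraseLead_of_leadingCoeff φ p h0
        have e2 := Polynomial.map_eraseLead_of_leadingCoeff φ' p (hz.1 h0)
        obtain ⟨t, ht, h1, h2, h3⟩ := h φ φ' (hag.mono (Set.subset_insert _ _)) (e1 ▸ hne)
        exact ⟨t, Set.mem_insert_of_mem _ ht, h1.trans e1, h2.trans e2, h3⟩
      · exact ⟨p, Set.mem_insert _ _, rfl, rfl, h0, fun h1 => h0 (hz.2 h1)⟩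

theorem exists_pseudo_remainder [IsDomain A] (t f : A[X]) (ht : 0 < t.natDegree) :
    ∃ (N : ℕ) (Q r : A[X]), C t.leadingCoeff ^ N * f = Q * t + r ∧ r.natDegree < t.natDegree := by
  induction hn : f.natDegree using Nat.strong_induction_on generalizing f with
  | _ n ih =>
    rcases lt_or_ge f.natDegree t.natDegree with hlt | hge
    · exact ⟨0, 0, f, by simp, hlt⟩
    · have h1 := natDegree_cancelLeads_lt_of_natDegree_le_natDegree hge (ht.trans_le hge)
      obtain ⟨N, Q, r, h2, h3⟩ := ih _ (hn ▸ h1) _ rfl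
      refine ⟨N + 1, Q + C t.leadingCoeff ^ N * (C f.leadingCoeff * X ^ (f.natDegree - t.natDegree)),
        r, ?_, h3⟩
      rw [cancelLeads, Nat.sub_eq_zero_of_le hge, pow_zero, mul_one] at h2
      linear_combination h2

/-- The even power is a positive multiplier wherever the leading coefficient survives, so `f` and
`r` have the same sign at zeros of `t`. -/
theorem exists_even_pseudo_remainder [IsDomain A] (t f : A[X]) (ht : 0 < t.natDegree) :
    ∃ (N : ℕ) (Q r : A[X]), C t.leadingCoeff ^ (2 * N) * f = Q * t + r ∧
      r.natDegree < t.natDegree := by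
  obtain ⟨N, Q, r, h1, h2⟩ := exists_pseudo_remainder t f ht
  refine ⟨N, C t.leadingCoeff ^ N * Q, C t.leadingCoeff ^ N * r, ?_, ?_⟩
  · linear_combination C t.leadingCoeff ^ N * h1
  · rw [← C_pow]
    exact (natDegree_C_mul_le _ _).trans_lt h2

/-- The sign diagram of the family `K` is determined by the signs of finitely many elements
of the coefficient ring. -/
def HasFiniteSignData (K : Set A[X]) : Prop :=
  ∃ G : Set A, G.Finite ∧ ∀ φ φ' : A →+* ℝ, SignAgree G φ φ' →
    ∃ R, SignMatch (fun i : K => i.1.map φ) (fun i : K => i.1.map φ') R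

theorem hasFiniteSignData_empty : HasFiniteSignData (∅ : Set A[X]) := by
  refine ⟨∅, Set.finite_empty, fun φ φ' _ => ⟨fun _ _ => True, ?_⟩⟩
  refine ⟨fun y => ⟨y, trivial⟩, fun y => ⟨y, trivial⟩, ?_, ?_⟩
  · rintro _ _ _ ⟨i, hi⟩; exact hi.elim
  · rintro _ _ _ _ _ _ _ _
    exact ⟨fun _ _ ⟨i, hi⟩ => hi.elim, fun _ _ ⟨i, hi⟩ => hi.elim⟩

theorem HasFiniteSignData.insert_C {K : Set A[X]} (h : HasFiniteSignData K) (a : A) :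
    HasFiniteSignData (insert (C a) K) := by
  obtain ⟨G, hG, h⟩ := h
  refine ⟨insert a G, hG.insert a, fun φ φ' hag => ?_⟩
  obtain ⟨R, hR⟩ := h φ φ' (hag.mono (Set.subset_insert _ _))
  refine ⟨R, hR.adjoin_C (hag a (Set.mem_insert _ _)) ?_⟩
  rintro ⟨j, rfl | hj⟩
  · exact Or.inr ⟨by simp, by simp⟩
  · exact Or.inl ⟨⟨j, hj⟩, rfl, rfl⟩

/-- At a zero of a nonzero specialization of a member of `K` or of f', the sign of `f` is that of
its remainder modulo a truncation; between such zeros `f` is monotone. If the leading coefficient of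
`f` specializes to zero, `f.eraseLead` takes its place. Every auxiliary polynomial has degree below
`d`. -/
theorem exists_hasFiniteSignData_insert [IsDomain A] {K : Set A[X]} (hK : K.Finite) {f : A[X]}
    (hf : 0 < f.natDegree) {d : ℕ} (hfd : f.natDegree ≤ d) (hKd : ∀ p ∈ K, p.natDegree ≤ d) :
    ∃ L : Set A[X], L.Finite ∧ (∀ p ∈ L, p.natDegree < d) ∧
      (HasFiniteSignData (K ∪ L) → HasFiniteSignData (insert f K)) := by
  choose T G hT hG hTd hTG using exists_truncations (A := A)
  choose! N Q r hr hrd using fun t => exists_even_pseudo_remainder (A := A) t f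
  have hder : (derivative f).natDegree < f.natDegree := natDegree_derivative_lt hf.ne'
  let K₀ : Set A[X] := insert (derivative f) K
  have hK₀ : K₀.Finite := hK.insert _
  let L : Set A[X] := {derivative f, f.eraseLead} ∪ r '' {t ∈ ⋃ p ∈ K₀, T p | 0 < t.natDegree}
  have hLfin : L.Finite := by
    refine Set.Finite.union (by simp) (Set.Finite.image _ (Set.Finite.subset ?_ (Set.sep_subset _ _)))
    exact hK₀.biUnion fun p _ => hT p
  refine ⟨L, hLfin, ?_, ?_⟩
  · rintro p ((rfl | rfl) | ⟨t, ⟨ht, ht0⟩, rfl⟩)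
    · exact hder.trans_le hfd
    · have := f.eraseLead_natDegree_le
      omega
    · refine (hrd t ht0).trans_le ?_
      simp only [Set.mem_iUnion] at ht
      obtain ⟨p, hp, htp⟩ := ht
      refine (hTd p t htp).trans ?_
      rcases hp with rfl | hp
      · exact hder.le.trans hfd
      · exact hKd p hp
  rintro ⟨G₁, hG₁, hmatch⟩
  let GT : Set A := ⋃ p ∈ K₀, G p
  refine ⟨insert f.leadingCoeff (G₁ ∪ GT), (hG₁.union (hK₀.biUnion fun p _ => hG p)).insert _,
    fun φ φ' hag => ?_⟩
  obtain ⟨R, hR⟩ := hmatch φ φ'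
    (hag.mono (Set.subset_union_left.trans (Set.subset_insert _ _)))
  have hlc := hag.eq_zero_iff (Set.mem_insert f.leadingCoeff _)
  by_cases h0 : φ f.leadingCoeff = 0
  · refine ⟨R, hR.of_forall_exists ?_⟩
    rintro ⟨j, rfl | hj⟩
    · exact ⟨⟨j.eraseLead, Or.inr (Or.inl (Or.inr rfl))⟩,
        (Polynomial.map_eraseLead_of_leadingCoeff φ j h0).symm,
        (Polynomial.map_eraseLead_of_leadingCoeff φ' j (hlc.1 h0)).symm⟩
    · exact ⟨⟨j, Or.inl hj⟩, rfl, rfl⟩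
  · have hR₀ : SignMatch (fun i : K₀ => i.1.map φ) (fun i : K₀ => i.1.map φ') R :=
      hR.of_forall_exists fun j => by
        rcases j with ⟨j, rfl | hj⟩
        · exact ⟨⟨_, Or.inr (Or.inl (Or.inl rfl))⟩, rfl, rfl⟩
        · exact ⟨⟨j, Or.inl hj⟩, rfl, rfl⟩
    have : Finite K₀ := hK₀
    have hf0 : derivative (f.map φ) ≠ 0 := by
      intro h
      have h1 := derivative_eq_zero.1 h
      rw [natDegree_map_of_leadingCoeff_ne_zero φ h0] at h1
      omega
    refine ⟨_, hR₀.refine_of_derivative (i₀ := ⟨derivative f, Set.mem_insert _ _⟩)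
      (f := f.map φ) (g := f.map φ') (derivative_map f φ).symm (derivative_map f φ').symm hf0 ?_ ?_⟩
    · rintro y y' hyy ⟨⟨p, hp⟩, hp0, hpy⟩
      simp only at hp0 hpy
      have hpy' : (p.map φ').eval y' = 0 := by
        have := hR₀.sign hyy ⟨p, hp⟩
        rwa [hpy, sign_zero, eq_comm, sign_eq_zero_iff] at this
      obtain ⟨t, ht, h1, h2, h3, h4⟩ := hTG p φ φ' (hag.mono (fun a ha =>
        Set.mem_insert_of_mem _ (Or.inr (Set.mem_biUnion hp ha)))) hp0
      have htd : 0 < t.natDegree := by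
        by_contra hd
        have hC := eq_C_of_natDegree_eq_zero (Nat.eq_zero_of_not_pos hd)
        rw [← h1, hC] at hpy
        rw [leadingCoeff, Nat.eq_zero_of_not_pos hd] at h3
        simp only [map_C, eval_C] at hpy
        exact h3 hpy
      have hrL : r t ∈ K ∪ L := Or.inr (Or.inr ⟨t, ⟨Set.mem_biUnion hp ht, htd⟩, rfl⟩)
      have hs := hR.sign hyy ⟨r t, hrL⟩
      have key : ∀ (χ : A →+* ℝ) (s : ℝ), χ t.leadingCoeff ≠ 0 → (t.map χ).eval s = 0 →
          SignType.sign ((f.map χ).eval s) = SignType.sign (((r t).map χ).eval s) := by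
        intro χ s hχ hts
        have e := congrArg (fun F => (F.map χ).eval s) (hr t htd)
        simp only [Polynomial.map_mul, Polynomial.map_pow, Polynomial.map_add, map_C, eval_mul,
          eval_pow, eval_C, eval_add, hts, mul_zero, zero_add] at e
        have hpos : 0 < χ t.leadingCoeff ^ (2 * N t) := by rw [pow_mul]; positivity
        rw [← e, sign_mul, sign_pos hpos, one_mul]
      rw [key φ y h3 (h1 ▸ hpy), key φ' y' h4 (h2 ▸ hpy')]
      exact hs
    · rintro ⟨j, rfl | hj⟩
      · exact Or.inr ⟨rfl, rfl⟩
      · exact Or.inl ⟨⟨j, Set.mem_insert_of_mem _ hj⟩, rfl, rfl⟩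

/-- Outer induction on the degree bound, inner induction on the set `H` of degree at most `d`. A
member of `H` is traded for finitely many polynomials of lower degree, which the arbitrary set `L`
absorbs. -/
theorem hasFiniteSignData_of_finite [IsDomain A] {K : Set A[X]} (hK : K.Finite) :
    HasFiniteSignData K := by
  have main : ∀ d : ℕ, ∀ L : Set A[X], L.Finite → (∀ p ∈ L, p.natDegree < d) →
      HasFiniteSignData L := by
    intro d
    induction d with
    | zero =>
      intro L _ hL
      rw [Set.eq_empty_of_forall_notMem fun p hp => absurd (hL p hp) (by omega)]
      exact hasFiniteSignData_empty
    | succ d ih =>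
      suffices hind : ∀ H : Set A[X], H.Finite → (∀ p ∈ H, p.natDegree ≤ d) →
          ∀ L : Set A[X], L.Finite → (∀ p ∈ L, p.natDegree < d) → HasFiniteSignData (L ∪ H) by
        intro L hLf hL
        have := hind L hLf (fun p hp => Nat.lt_succ_iff.1 (hL p hp)) ∅ Set.finite_empty (by simp)
        rwa [Set.empty_union] at this
      intro H hH
      induction H, hH using Set.Finite.induction_on with
      | empty => intro _ L hL hLd; rw [Set.union_empty]; exact ih L hL hLd
      | @insert f H _ hH ihH =>
        intro hHd L hL hLd
        have hHd' : ∀ p ∈ H, p.natDegree ≤ d := fun p hp => hHd p (Set.mem_insert_of_mem _ hp)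
        rw [Set.union_insert]
        rcases Nat.eq_zero_or_pos f.natDegree with h0 | hpos
        · rw [eq_C_of_natDegree_eq_zero h0]
          exact (ihH hHd' L hL hLd).insert_C _
        · obtain ⟨L', hL', hLd', himp⟩ := exists_hasFiniteSignData_insert (K := L ∪ H) (d := d)
            (hL.union hH) hpos (hHd f (Set.mem_insert _ _)) (by
              rintro p (hp | hp)
              · exact (hLd p hp).le
              · exact hHd' p hp)
          apply himp
          rw [Set.union_right_comm]
          exact ihH hHd' (L ∪ L') (hL.union hL') (by
            rintro p (hp | hp)
            · exact hLd p hp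
            · exact hLd' p hp)
  obtain ⟨d, hd⟩ := (hK.image natDegree).bddAbove
  exact main (d + 1) K hK fun p hp => Nat.lt_succ_iff.2 (hd ⟨p, hp, rfl⟩)

end parametric

end

/-! ### The Tarski–Seidenberg theorem. -/

namespace IsSemialgebraic

open MvPolynomial

variable {ι κ : Type*}

theorem empty : IsSemialgebraic (∅ : Set (ι → ℝ)) := by
  simpa using IsSemialgebraic.pos (ι := ι) 0

theorem biUnion {α : Type*} {s : Set α} (hs : s.Finite) {S : α → Set (ι → ℝ)}
    (h : ∀ a ∈ s, IsSemialgebraic (S a)) : IsSemialgebraic (⋃ a ∈ s, S a) := by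
  induction s, hs using Set.Finite.induction_on with
  | empty => simpa using empty
  | @insert a s _ _ ih =>
    rw [Set.biUnion_insert]
    exact (h a (Set.mem_insert _ _)).union (ih fun b hb => h b (Set.mem_insert_of_mem _ hb))

theorem biInter {α : Type*} {s : Set α} (hs : s.Finite) {S : α → Set (ι → ℝ)}
    (h : ∀ a ∈ s, IsSemialgebraic (S a)) : IsSemialgebraic (⋂ a ∈ s, S a) := by
  have := (biUnion hs fun a ha => (h a ha).compl).compl
  simpa [Set.compl_iUnion] using this

theorem neg (f : MvPolynomial ι ℝ) : IsSemialgebraic {x | eval x f < 0} := by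
  simpa using IsSemialgebraic.pos (-f)

theorem eq_zero (f : MvPolynomial ι ℝ) : IsSemialgebraic {x | eval x f = 0} := by
  convert ((IsSemialgebraic.pos f).union (neg f)).compl using 1
  ext x
  simp only [Set.mem_ofPred_eq, Set.mem_compl_iff, Set.mem_union, not_or, not_lt]
  exact le_antisymm_iff

theorem sign_eq (f : MvPolynomial ι ℝ) (s : SignType) :
    IsSemialgebraic {x | SignType.sign (eval x f) = s} := by
  cases s
  · simpa [sign_eq_zero_iff] using eq_zero f
  · simpa [sign_eq_neg_one_iff] using neg f
  · simpa [sign_eq_one_iff] using IsSemialgebraic.pos f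

/-- Membership in `S` depends only on the signs of the polynomials in `G`. -/
def _root_.SignDetermined (G : Set (MvPolynomial ι ℝ)) (S : Set (ι → ℝ)) : Prop :=
  ∀ x x', (∀ g ∈ G, SignType.sign (eval x g) = SignType.sign (eval x' g)) → x ∈ S → x' ∈ S

/-- Finitely many polynomials have finitely many sign patterns, and `S` is the union of the sign
cells it contains. Quantifier elimination works on this form. -/
theorem _root_.isSemialgebraic_iff_signDetermined {S : Set (ι → ℝ)} :
    IsSemialgebraic S ↔ ∃ G : Set (MvPolynomial ι ℝ), G.Finite ∧ SignDetermined G S := by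
  constructor
  · intro h
    induction h with
    | pos f =>
      refine ⟨{f}, Set.finite_singleton f, fun x x' hx h => ?_⟩
      have := hx f rfl
      rw [sign_pos h, eq_comm, sign_eq_one_iff] at this
      exact this
    | union _ _ h1 h2 =>
      obtain ⟨G, hG, h1⟩ := h1
      obtain ⟨H, hH, h2⟩ := h2
      refine ⟨G ∪ H, hG.union hH, fun x x' hx h => ?_⟩
      rcases h with h | h
      · exact Or.inl (h1 x x' (fun g hg => hx g (Or.inl hg)) h)
      · exact Or.inr (h2 x x' (fun g hg => hx g (Or.inr hg)) h)
    | inter _ _ h1 h2 =>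
      obtain ⟨G, hG, h1⟩ := h1
      obtain ⟨H, hH, h2⟩ := h2
      exact ⟨G ∪ H, hG.union hH, fun x x' hx h => ⟨h1 x x' (fun g hg => hx g (Or.inl hg)) h.1,
        h2 x x' (fun g hg => hx g (Or.inr hg)) h.2⟩⟩
    | compl _ h1 =>
      obtain ⟨G, hG, h1⟩ := h1
      exact ⟨G, hG, fun x x' hx h h' => h (h1 x' x (fun g hg => (hx g hg).symm) h')⟩
  · rintro ⟨G, hG, h⟩
    have : Finite G := hG
    let cell : (G → SignType) → Set (ι → ℝ) := fun σ =>
      ⋂ g ∈ (Set.univ : Set G), {x | SignType.sign (eval x g.1) = σ g}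
    have hS : S = ⋃ σ ∈ {σ | cell σ ⊆ S}, cell σ := by
      ext x
      simp only [Set.mem_iUnion, exists_prop]
      constructor
      · intro hx
        refine ⟨fun g => SignType.sign (eval x g.1), fun x' hx' => ?_, by simp [cell]⟩
        refine h x x' (fun g hg => ?_) hx
        simp only [cell, Set.mem_iInter] at hx'
        exact (hx' ⟨g, hg⟩ trivial).symm
      · rintro ⟨σ, h1, h2⟩
        exact h1 h2
    rw [hS]
    exact biUnion (Set.toFinite _) fun σ _ => biInter (Set.toFinite _) fun g _ => sign_eq _ _

theorem preimage_comp {S : Set (ι → ℝ)} (hS : IsSemialgebraic S) (e : ι → κ) :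
    IsSemialgebraic {x : κ → ℝ | x ∘ e ∈ S} := by
  induction hS with
  | pos f => simpa [eval_rename] using IsSemialgebraic.pos (rename e f)
  | union _ _ h1 h2 => exact h1.union h2
  | inter _ _ h1 h2 => exact h1.inter h2
  | compl _ h1 => exact h1.compl

/-- Elimination of one quantifier. -/
theorem exists_option {S : Set (Option ι → ℝ)} (hS : IsSemialgebraic S) :
    IsSemialgebraic {x : ι → ℝ | ∃ y : ℝ, (fun o => Option.elim o y x) ∈ S} := by
  rw [isSemialgebraic_iff_signDetermined] at hS ⊢
  obtain ⟨G, hG, hS⟩ := hS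
  -- The eliminated variable becomes the polynomial variable, and the others become parameters.
  obtain ⟨G', hG', h⟩ := hasFiniteSignData_of_finite (hG.image (optionEquivLeft ℝ ι))
  refine ⟨G', hG', fun x x' hx => ?_⟩
  rintro ⟨y, hy⟩
  obtain ⟨R, hR⟩ := h (eval x) (eval x') hx
  obtain ⟨y', hyy⟩ := hR.left y
  refine ⟨y', hS _ _ (fun g hg => ?_) hy⟩
  have key : ∀ (z : ι → ℝ) (t : ℝ), eval (fun o => Option.elim o t z) g =
      ((optionEquivLeft ℝ ι g).map (eval z)).eval t := by
    intro z t
    have : (Polynomial.evalRingHom t).comp ((Polynomial.mapRingHom (eval z)).comp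
        (optionEquivLeft ℝ ι : MvPolynomial (Option ι) ℝ →+* _)) =
        eval (fun o => Option.elim o t z) := by
      apply MvPolynomial.ringHom_ext
      · intro r; simp
      · rintro (_ | i) <;> simp
    exact (congrArg (fun F => F g) this).symm
  have := hR.sign hyy ⟨_, Set.mem_image_of_mem _ hg⟩
  rw [key, key]
  exact this

/-- The **Tarski–Seidenberg theorem**: projections of semialgebraic sets are semialgebraic. -/
theorem exists_sum [Finite κ] {S : Set (ι ⊕ κ → ℝ)} (hS : IsSemialgebraic S) :
    IsSemialgebraic {x : ι → ℝ | ∃ y : κ → ℝ, Sum.elim x y ∈ S} := by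
  induction κ using Finite.induction_empty_option with
  | @of_equiv α β e ih =>
    convert ih (hS.preimage_comp (Sum.map id e.symm)) using 1
    ext x
    constructor
    · rintro ⟨y, hy⟩
      refine ⟨y ∘ e, ?_⟩
      refine Set.mem_of_eq_of_mem (s := S) ?_ hy
      ext (i | j) <;> simp
    · rintro ⟨y, hy⟩
      refine ⟨y ∘ e.symm, ?_⟩
      refine Set.mem_of_eq_of_mem (s := S) ?_ hy
      ext (i | j) <;> simp
  | h_empty =>
    convert hS.preimage_comp (Sum.elim id PEmpty.elim) using 1
    ext x
    constructor
    · rintro ⟨y, hy⟩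
      refine Set.mem_of_eq_of_mem (s := S) ?_ hy
      ext (i | j)
      · rfl
      · exact j.elim
    · intro hx
      refine ⟨PEmpty.elim, ?_⟩
      refine Set.mem_of_eq_of_mem (s := S) ?_ hx
      ext (i | j)
      · rfl
      · exact j.elim
  | @h_option α _ ih =>
    let e : ι ⊕ Option α → Option (ι ⊕ α) :=
      Sum.elim (fun i => some (Sum.inl i)) (fun o => o.elim none fun j => some (Sum.inr j))
    convert ih (hS.preimage_comp e).exists_option using 1
    ext x
    constructor
    · rintro ⟨y, hy⟩
      refine ⟨fun j => y (some j), y none, ?_⟩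
      refine Set.mem_of_eq_of_mem (s := S) ?_ hy
      ext (i | _ | j) <;> rfl
    · rintro ⟨y, t, hy⟩
      refine ⟨fun o => o.elim t y, ?_⟩
      refine Set.mem_of_eq_of_mem (s := S) ?_ hy
      ext (i | _ | j) <;> rfl

theorem rationalImage [Finite ι] [Finite κ] (g : ι → MvPolynomial κ ℝ) (Z : MvPolynomial κ ℝ)
    (hZ : ∀ x : κ → ℝ, (∀ i, 0 < x i) → 0 < eval x Z) : IsSemialgebraic (rationalImage g Z) := by
  have h1 : IsSemialgebraic {z : ι ⊕ κ → ℝ | (∀ j, 0 < z (Sum.inr j)) ∧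
      ∀ v, z (Sum.inl v) * eval (z ∘ Sum.inr) Z = eval (z ∘ Sum.inr) (g v)} := by
    convert (biInter (Set.finite_univ (α := κ)) fun j _ =>
      IsSemialgebraic.pos (X (Sum.inr j : ι ⊕ κ))).inter
      (biInter (Set.finite_univ (α := ι)) fun v _ =>
        eq_zero (X (Sum.inl v) * rename Sum.inr Z - rename (Sum.inr : κ → ι ⊕ κ) (g v))) using 1
    ext z
    simp [eval_rename, sub_eq_zero]
  convert h1.exists_sum using 1
  ext p
  constructor
  · rintro ⟨x, hx, rfl⟩
    refine ⟨x, hx, fun v => ?_⟩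
    simp [(hZ x hx).ne']
  · rintro ⟨x, hx, h⟩
    refine ⟨x, hx, funext fun v => ?_⟩
    rw [eq_div_iff (hZ x hx).ne']
    exact h v

end IsSemialgebraic

/-! ### The model as a rational image of the positive orthant. -/

section model

/-- Index type of the parameters `W`, `b`, `c` of the RBM model. -/
abbrev RBMParam (n k : ℕ) : Type := (Fin k × Fin n) ⊕ (Fin n ⊕ Fin k)

variable {n k : ℕ}

/-- The polynomial `∑_h ∏ ω_{ij}^{h_i v_j} ∏ β_j^{v_j} ∏ γ_i^{h_i}`. -/
noncomputable def rbmPoly (n k : ℕ) (v : Fin n → Fin 2) : MvPolynomial (RBMParam n k) ℝ :=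
  ∑ h : Fin k → Fin 2,
    (∏ i, ∏ j, MvPolynomial.X (Sum.inl (i, j)) ^ ((h i : ℕ) * (v j : ℕ))) *
      (∏ j, MvPolynomial.X (Sum.inr (Sum.inl j)) ^ (v j : ℕ)) *
      ∏ i, MvPolynomial.X (Sum.inr (Sum.inr i)) ^ (h i : ℕ)

/-- The parameter matrix and vectors encoded by a point of the parameter space. -/
def paramW (θ : RBMParam n k → ℝ) : Matrix (Fin k) (Fin n) ℝ := fun i j => θ (Sum.inl (i, j))

/-- The visible biases encoded by a point of the parameter space. -/
def paramB (θ : RBMParam n k → ℝ) : Fin n → ℝ := fun j => θ (Sum.inr (Sum.inl j))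

/-- The hidden biases encoded by a point of the parameter space. -/
def paramC (θ : RBMParam n k → ℝ) : Fin k → ℝ := fun i => θ (Sum.inr (Sum.inr i))

theorem eval_rbmPoly (θ : RBMParam n k → ℝ) (v : Fin n → Fin 2) :
    MvPolynomial.eval (fun a => Real.exp (θ a)) (rbmPoly n k v) =
      ∑ h, rbmPsi (paramW θ) (paramB θ) (paramC θ) v h := by
  simp only [rbmPoly, map_sum, map_mul, map_prod, map_pow, MvPolynomial.eval_X]
  refine Finset.sum_congr rfl fun h _ => ?_
  simp only [rbmPsi, ← Real.exp_nat_mul, ← Real.exp_sum, ← Real.exp_add]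
  congr 1
  simp only [dotProduct, Matrix.mulVec, stateVec, paramW, paramB, paramC, Finset.mul_sum]
  push_cast
  congr 1
  · congr 1
    · exact Finset.sum_congr rfl fun i _ => Finset.sum_congr rfl fun j _ => by ring
    · exact Finset.sum_congr rfl fun j _ => by ring
  · exact Finset.sum_congr rfl fun j _ => by ring

theorem rbmPsi_pos (W : Matrix (Fin k) (Fin n) ℝ) (b : Fin n → ℝ) (c : Fin k → ℝ)
    (v : Fin n → Fin 2) (h : Fin k → Fin 2) : 0 < rbmPsi W b c v h := Real.exp_pos _

theorem sum_rbmPsi_pos (W : Matrix (Fin k) (Fin n) ℝ) (b : Fin n → ℝ) (c : Fin k → ℝ)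
    (v : Fin n → Fin 2) : 0 < ∑ h, rbmPsi W b c v h :=
  Finset.sum_pos (fun _ _ => rbmPsi_pos _ _ _ _ _) Finset.univ_nonempty

theorem rbmZ_pos (W : Matrix (Fin k) (Fin n) ℝ) (b : Fin n → ℝ) (c : Fin k → ℝ) :
    0 < rbmZ W b c :=
  Finset.sum_pos (fun _ _ => sum_rbmPsi_pos _ _ _ _) Finset.univ_nonempty

theorem rbmModel_subset_openSimplex (n k : ℕ) :
    rbmModel n k ⊆ openSimplex (Fin n → Fin 2) := by
  rintro _ ⟨W, b, c, rfl⟩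
  refine ⟨fun v => mul_pos (one_div_pos.2 (rbmZ_pos _ _ _)) (sum_rbmPsi_pos _ _ _ _), ?_⟩
  simp only [rbmProb]
  rw [← Finset.mul_sum]
  exact one_div_mul_cancel (rbmZ_pos W b c).ne'

theorem eval_sum_rbmPoly (θ : RBMParam n k → ℝ) :
    MvPolynomial.eval (fun a => Real.exp (θ a)) (∑ v, rbmPoly n k v) =
      rbmZ (paramW θ) (paramB θ) (paramC θ) := by
  rw [map_sum]
  exact Finset.sum_congr rfl fun v _ => eval_rbmPoly θ v

theorem exists_exp_eq {σ : Type*} {x : σ → ℝ} (hx : ∀ i, 0 < x i) :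
    ∃ θ : σ → ℝ, x = fun a => Real.exp (θ a) :=
  ⟨fun a => Real.log (x a), funext fun a => (Real.exp_log (hx a)).symm⟩

theorem eval_sum_rbmPoly_pos (x : RBMParam n k → ℝ) (hx : ∀ i, 0 < x i) :
    0 < MvPolynomial.eval x (∑ v, rbmPoly n k v) := by
  obtain ⟨θ, rfl⟩ := exists_exp_eq hx
  rw [eval_sum_rbmPoly]
  exact rbmZ_pos _ _ _

theorem rbmModel_eq_range (n k : ℕ) : rbmModel n k =
    Set.range fun θ : RBMParam n k → ℝ => rbmProb (paramW θ) (paramB θ) (paramC θ) := by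
  ext p
  constructor
  · rintro ⟨W, b, c, rfl⟩
    exact ⟨Sum.elim (fun ij => W ij.1 ij.2) (Sum.elim b c), rfl⟩
  · rintro ⟨θ, rfl⟩
    exact ⟨_, _, _, rfl⟩

theorem rbmModel_eq_rationalImage (n k : ℕ) :
    rbmModel n k = rationalImage (rbmPoly n k) (∑ v, rbmPoly n k v) := by
  have h : ∀ θ : RBMParam n k → ℝ, rbmProb (paramW θ) (paramB θ) (paramC θ) = fun v =>
      MvPolynomial.eval (fun a => Real.exp (θ a)) (rbmPoly n k v) /
        MvPolynomial.eval (fun a => Real.exp (θ a)) (∑ v, rbmPoly n k v) := by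
    intro θ
    ext v
    rw [eval_sum_rbmPoly, eval_rbmPoly, rbmProb, one_div_mul_eq_div]
  rw [rbmModel_eq_range]
  ext p
  constructor
  · rintro ⟨θ, rfl⟩
    exact ⟨_, fun a => Real.exp_pos (θ a), h θ⟩
  · rintro ⟨x, hx, rfl⟩
    obtain ⟨θ, rfl⟩ := exists_exp_eq hx
    exact ⟨θ, h θ⟩

theorem isSemialgebraic_rbmModel (n k : ℕ) : IsSemialgebraic (rbmModel n k) := by
  rw [rbmModel_eq_rationalImage]
  exact IsSemialgebraic.rationalImage _ _ eval_sum_rbmPoly_pos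

theorem isDomain_rbmCoordinateRing (n k : ℕ) :
    IsDomain (MvPolynomial (Fin n → Fin 2) ℝ ⧸ MvPolynomial.vanishingIdeal ℝ (rbmModel n k)) := by
  rw [rbmModel_eq_rationalImage]
  exact isDomain_coordinateRing _ _ eval_sum_rbmPoly_pos

theorem semialgebraicDim_rbmModel_le (n k : ℕ) :
    semialgebraicDim (rbmModel n k) ≤ ((n * k + n + k : ℕ) : WithBot ℕ∞) := by
  rw [rbmModel_eq_rationalImage]
  refine (semialgebraicDim_rationalImage_le _ _ eval_sum_rbmPoly_pos).trans_eq ?_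
  congr 2
  simp
  ring

theorem semialgebraicDim_rbmModel_le_simplex (n k : ℕ) :
    semialgebraicDim (rbmModel n k) ≤ ((2 ^ n - 1 : ℕ) : WithBot ℕ∞) := by
  have h := semialgebraicDim_add_one_le_card _ (rbmModel_subset_openSimplex n k)
  have := isDomain_rbmCoordinateRing n k
  obtain ⟨s, h1, -⟩ := ringKrullDim_eq_trdeg ℝ
    (MvPolynomial (Fin n → Fin 2) ℝ ⧸ MvPolynomial.vanishingIdeal ℝ (rbmModel n k))
  rw [semialgebraicDim, h1] at h ⊢
  have h2 : s + 1 ≤ 2 ^ n := by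
    have h3 : Fintype.card (Fin n → Fin 2) = 2 ^ n := by simp
    rw [h3] at h
    exact_mod_cast h
  have h4 : s ≤ 2 ^ n - 1 := by omega
  exact_mod_cast h4

end model

/-! ### Differentials of softmax and softplus. -/

section differential

/-- The map `x ↦ exp x / ∑ exp x`. -/
noncomputable def softmax {V : Type*} [Fintype V] (x : V → ℝ) (v : V) : ℝ :=
  Real.exp (x v) * (∑ u, Real.exp (x u))⁻¹

/-- With p = softmax x, the differential sends δ to p(v)(δ(v) - Σ p(u)δ(u)), which vanishes only if
δ equals its mean everywhere. -/
theorem exists_hasStrictFDerivAt_softmax {V : Type*} [Fintype V] [Nonempty V] (x : V → ℝ) :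
    ∃ D : (V → ℝ) →L[ℝ] (V → ℝ), HasStrictFDerivAt softmax D x ∧
      ∀ δ, D δ = 0 ↔ ∃ a : ℝ, δ = fun _ => a := by
  set Z := ∑ u, Real.exp (x u) with hZ
  have hZpos : 0 < Z := Finset.sum_pos (fun _ _ => Real.exp_pos _) Finset.univ_nonempty
  have he : ∀ v, HasStrictFDerivAt (fun y : V → ℝ => Real.exp (y v))
      (Real.exp (x v) • ContinuousLinearMap.proj (R := ℝ) (φ := fun _ : V => ℝ) v) x := fun v =>
    (hasStrictFDerivAt_apply (𝕜 := ℝ) (F' := fun _ : V => ℝ) v x).exp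
  have hs := HasStrictFDerivAt.fun_sum (u := Finset.univ) fun v _ => he v
  have hi := (hasStrictDerivAt_inv hZpos.ne').comp_hasStrictFDerivAt x hs
  refine ⟨_, hasStrictFDerivAt_pi.2 fun v => (he v).mul hi, fun δ => ?_⟩
  have hD : ∀ v, Real.exp (x v) * (-(Z ^ 2)⁻¹ * ∑ u, Real.exp (x u) * δ u) +
      Z⁻¹ * (Real.exp (x v) * δ v) = 0 ↔ δ v = Z⁻¹ * ∑ u, Real.exp (x u) * δ u := by
    intro v
    have hv := (Real.exp_pos (x v)).ne'
    have : Real.exp (x v) * (-(Z ^ 2)⁻¹ * ∑ u, Real.exp (x u) * δ u) +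
        Z⁻¹ * (Real.exp (x v) * δ v) =
        Real.exp (x v) * Z⁻¹ * (δ v - Z⁻¹ * ∑ u, Real.exp (x u) * δ u) := by
      field_simp
      ring
    rw [this, mul_eq_zero, or_iff_right (mul_ne_zero hv (inv_ne_zero hZpos.ne')), sub_eq_zero]
  constructor
  · intro h
    refine ⟨Z⁻¹ * ∑ u, Real.exp (x u) * δ u, funext fun v => (hD v).1 ?_⟩
    have := congrFun h v
    simpa using this
  · rintro ⟨a, rfl⟩
    ext v
    have := (hD v).2 (by rw [← Finset.sum_mul, ← hZ]; field_simp)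
    simpa using this

theorem hasStrictDerivAt_softplus (t : ℝ) :
    HasStrictDerivAt (fun s => Real.log (1 + Real.exp s)) (Real.exp t / (1 + Real.exp t)) t :=
  (((Real.hasStrictDerivAt_exp t).const_add 1).log (by positivity))

theorem exists_linearMap_comp_surjective {E F : Type*} [AddCommGroup E] [Module ℝ E]
    [AddCommGroup F] [Module ℝ F] [FiniteDimensional ℝ F] (L : E →ₗ[ℝ] F) {m : ℕ}
    (hm : m ≤ Module.finrank ℝ (LinearMap.range L)) :
    ∃ π : F →ₗ[ℝ] (Fin m → ℝ), Function.Surjective (π ∘ₗ L) := by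
  obtain ⟨f, hf⟩ := LinearMap.exists_leftInverse_of_injective (LinearMap.range L).subtype
    (by simp)
  let b := Module.finBasis ℝ (LinearMap.range L)
  let g : LinearMap.range L →ₗ[ℝ] (Fin m → ℝ) :=
    LinearMap.funLeft ℝ ℝ (Fin.castLE hm) ∘ₗ b.equivFun.toLinearMap
  have hg : Function.Surjective g :=
    (LinearMap.funLeft_surjective_of_injective ℝ ℝ _ (Fin.castLE_injective hm)).comp
      b.equivFun.surjective
  refine ⟨g ∘ₗ f, fun y => ?_⟩
  obtain ⟨⟨_, x, rfl⟩, rfl⟩ := hg y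
  refine ⟨x, ?_⟩
  have := congrArg (fun F => F ⟨L x, x, rfl⟩) hf
  simp only [LinearMap.comp_apply, Submodule.subtype_apply, LinearMap.id_apply] at this ⊢
  rw [this]

end differential

/-! ### The rank of the Jacobian and its limit at infinity. -/

section tangent

variable {n k : ℕ}

/-- The total input `W_i v + c_i` of the hidden node `i`, as a function of the parameters. -/
noncomputable def hiddenField (v : Fin n → Fin 2) (i : Fin k) : (RBMParam n k → ℝ) →L[ℝ] ℝ :=
  ∑ j, stateVec v j • ContinuousLinearMap.proj (Sum.inl (i, j)) +
    ContinuousLinearMap.proj (Sum.inr (Sum.inr i))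

/-- The linear form `bᵀ v` in the parameters. -/
noncomputable def visibleField (k : ℕ) (v : Fin n → Fin 2) : (RBMParam n k → ℝ) →L[ℝ] ℝ :=
  ∑ j, stateVec v j • ContinuousLinearMap.proj (Sum.inr (Sum.inl j))

theorem hiddenField_apply (v : Fin n → Fin 2) (i : Fin k) (θ : RBMParam n k → ℝ) :
    hiddenField v i θ = ∑ j, stateVec v j * paramW θ i j + paramC θ i := by
  simp [hiddenField, paramW, paramC]

theorem visibleField_apply (v : Fin n → Fin 2) (θ : RBMParam n k → ℝ) :
    visibleField k v θ = ∑ j, stateVec v j * paramB θ j := by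
  simp [visibleField, paramB]

/-- The logarithm of the unnormalized probability of `v`. -/
noncomputable def rbmLog (θ : RBMParam n k → ℝ) (v : Fin n → Fin 2) : ℝ :=
  visibleField k v θ + ∑ i, Real.log (1 + Real.exp (hiddenField v i θ))

/-- For fixed `v` the hidden nodes are independent, so the sum over `h` factors into a product over
the nodes. -/
theorem sum_rbmPsi_eq_exp (θ : RBMParam n k → ℝ) (v : Fin n → Fin 2) :
    ∑ h, rbmPsi (paramW θ) (paramB θ) (paramC θ) v h = Real.exp (rbmLog θ v) := by
  have h1 : ∀ h : Fin k → Fin 2, rbmPsi (paramW θ) (paramB θ) (paramC θ) v h =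
      Real.exp (visibleField k v θ) * ∏ i, Real.exp ((h i : ℕ) * hiddenField v i θ) := by
    intro h
    rw [rbmPsi, ← Real.exp_sum, ← Real.exp_add]
    congr 1
    simp only [hiddenField_apply, visibleField_apply, dotProduct, Matrix.mulVec, mul_add,
      Finset.sum_add_distrib]
    have e1 : ∀ x, stateVec h x = ((h x : ℕ) : ℝ) := fun _ => rfl
    have e2 : ∑ i, paramB θ i * stateVec v i = ∑ i, stateVec v i * paramB θ i :=
      Finset.sum_congr rfl fun _ _ => mul_comm _ _
    have e3 : ∑ i, paramC θ i * stateVec h i = ∑ i, ((h i : ℕ) : ℝ) * paramC θ i :=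
      Finset.sum_congr rfl fun _ _ => mul_comm _ _
    have e4 : ∑ i, stateVec h i * ∑ j, paramW θ i j * stateVec v j =
        ∑ i, ((h i : ℕ) : ℝ) * ∑ j, stateVec v j * paramW θ i j :=
      Finset.sum_congr rfl fun _ _ => congrArg _ (Finset.sum_congr rfl fun _ _ => mul_comm _ _)
    rw [e2, e3, e4]
    ring
  simp_rw [h1, ← Finset.mul_sum]
  rw [rbmLog, Real.exp_add, Real.exp_sum]
  congr 1
  have h2 := Finset.prod_univ_sum (R := ℝ) (fun _ : Fin k => (Finset.univ : Finset (Fin 2)))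
    (fun i a => Real.exp ((a : ℕ) * hiddenField v i θ))
  rw [Fintype.piFinset_univ] at h2
  rw [← h2]
  refine Finset.prod_congr rfl fun i _ => ?_
  rw [Real.exp_log (by positivity)]
  simp [Fin.sum_univ_two]

theorem rbmProb_eq_softmax (θ : RBMParam n k → ℝ) :
    rbmProb (paramW θ) (paramB θ) (paramC θ) = softmax (rbmLog θ) := by
  ext v
  rw [rbmProb, rbmZ, softmax]
  simp_rw [sum_rbmPsi_eq_exp]
  rw [one_div, mul_comm]

/-- The span of the affine functions and of their products with the functions `a i`, as a linear
image of the parameter space. -/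
noncomputable def slicingMap (a : Fin k → (Fin n → Fin 2) → ℝ) :
    ℝ × (RBMParam n k → ℝ) →L[ℝ] ((Fin n → Fin 2) → ℝ) :=
  ContinuousLinearMap.pi fun v => ContinuousLinearMap.fst ℝ _ _ +
    (visibleField k v + ∑ i, a i v • hiddenField v i) ∘L ContinuousLinearMap.snd ℝ _ _

theorem slicingMap_apply (a : Fin k → (Fin n → Fin 2) → ℝ) (x : ℝ × (RBMParam n k → ℝ))
    (v : Fin n → Fin 2) : slicingMap a x v =
      x.1 + (visibleField k v x.2 + ∑ i, a i v * hiddenField v i x.2) := by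
  simp [slicingMap]

theorem continuous_slicingMap : Continuous (slicingMap (n := n) (k := k)) := by
  refine continuous_clm_apply.2 fun x => continuous_pi fun v => ?_
  simp only [slicingMap_apply]
  fun_prop

theorem hasStrictFDerivAt_rbmLog (θ : RBMParam n k → ℝ) :
    HasStrictFDerivAt rbmLog (slicingMap (fun i v => Real.exp (hiddenField v i θ) /
      (1 + Real.exp (hiddenField v i θ))) ∘L ContinuousLinearMap.inr ℝ ℝ (RBMParam n k → ℝ)) θ := by
  rw [hasStrictFDerivAt_pi']
  intro v
  have h1 := (visibleField k v).hasStrictFDerivAt (x := θ)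
  have h2 := HasStrictFDerivAt.fun_sum (u := Finset.univ) fun (i : Fin k) _ =>
    (hasStrictDerivAt_softplus (hiddenField v i θ)).comp_hasStrictFDerivAt θ
      (hiddenField v i).hasStrictFDerivAt
  refine (h1.add h2).congr_fderiv ?_
  ext δ
  simp [slicingMap_apply]

/-- The extra scalar coordinate of `slicingMap` contributes only constants, and these are the whole
kernel of `D`, so at most one dimension is lost. -/
theorem finrank_range_slicingMap_le (a : Fin k → (Fin n → Fin 2) → ℝ)
    (D : ((Fin n → Fin 2) → ℝ) →L[ℝ] ((Fin n → Fin 2) → ℝ))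
    (hD : ∀ δ, D δ = 0 ↔ ∃ c : ℝ, δ = fun _ => c) :
    Module.finrank ℝ (LinearMap.range (slicingMap a).toLinearMap) ≤
      Module.finrank ℝ (LinearMap.range (D ∘L slicingMap a ∘L
        ContinuousLinearMap.inr ℝ ℝ (RBMParam n k → ℝ)).toLinearMap) + 1 := by
  set T := LinearMap.range (slicingMap a).toLinearMap with hT
  have hone : (fun _ => 1 : (Fin n → Fin 2) → ℝ) ∈ T :=
    ⟨(1, 0), by ext v; simp [slicingMap_apply]⟩
  let DT := D.toLinearMap.domRestrict T
  have hker : Module.finrank ℝ (LinearMap.ker DT) ≤ 1 := by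
    refine finrank_le_one ⟨⟨_, hone⟩, (hD _).2 ⟨1, rfl⟩⟩ ?_
    rintro ⟨⟨δ, hδ⟩, hk⟩
    obtain ⟨c, hc⟩ := (hD δ).1 hk
    refine ⟨c, ?_⟩
    ext v
    simp [hc]
  have hle : LinearMap.range DT ≤ LinearMap.range (D ∘L slicingMap a ∘L
        ContinuousLinearMap.inr ℝ ℝ (RBMParam n k → ℝ)).toLinearMap := by
    rintro _ ⟨⟨_, ⟨⟨s, δ⟩, rfl⟩⟩, rfl⟩
    refine ⟨δ, ?_⟩
    have h1 : slicingMap a (s, δ) = slicingMap a (0, δ) + fun _ => s := by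
      ext v
      simp only [slicingMap_apply, Pi.add_apply]
      ring
    have h2 : D (fun _ => s) = 0 := (hD _).2 ⟨s, rfl⟩
    change D (slicingMap a (0, δ)) = D (slicingMap a (s, δ))
    rw [h1, map_add, h2, add_zero]
  have h1 := LinearMap.finrank_range_add_finrank_ker DT
  have h2 := Submodule.finrank_mono hle
  omega

/-- A suitable linear projection makes the differential at `θ` surjective onto ℝ^m; local
surjectivity then gives the projected model interior points. -/
theorem le_semialgebraicDim_of_slicingMap (θ : RBMParam n k → ℝ) {m : ℕ}
    (hm : m + 1 ≤ Module.finrank ℝ (LinearMap.range (slicingMap fun i v =>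
      Real.exp (hiddenField v i θ) / (1 + Real.exp (hiddenField v i θ))).toLinearMap)) :
    (m : WithBot ℕ∞) ≤ semialgebraicDim (rbmModel n k) := by
  obtain ⟨D, hD, hDker⟩ := exists_hasStrictFDerivAt_softmax (rbmLog θ)
  have hcomp := hD.comp θ (hasStrictFDerivAt_rbmLog θ)
  obtain ⟨π, hπ⟩ := exists_linearMap_comp_surjective _
    (Nat.le_of_succ_le_succ (hm.trans (finrank_range_slicingMap_le _ D hDker)))
  have := isDomain_rbmCoordinateRing n k
  refine le_semialgebraicDim_of_interior_image _ π ?_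
  let πc := LinearMap.toContinuousLinearMap π
  have hG := (πc.hasStrictFDerivAt (x := softmax (rbmLog θ))).comp θ hcomp
  have hmap := hG.map_nhds_eq_of_surj (LinearMap.range_eq_top.2 hπ)
  refine ⟨_, mem_interior_iff_mem_nhds.2 (Filter.mem_of_superset (hmap ▸
    Filter.image_mem_map Filter.univ_mem) ?_)⟩
  rintro _ ⟨η, -, rfl⟩
  refine ⟨softmax (rbmLog η), ?_, rfl⟩
  rw [rbmModel_eq_range]
  exact ⟨η, rbmProb_eq_softmax η⟩

theorem tendsto_sigmoid_mul {a : ℝ} (ha : a ≠ 0) :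
    Filter.Tendsto (fun t : ℝ => Real.exp (t * a) / (1 + Real.exp (t * a))) Filter.atTop
      (nhds (if 0 < a then 1 else 0)) := by
  rcases lt_or_gt_of_ne ha with h | h
  · rw [if_neg h.le.not_gt]
    have h1 : Filter.Tendsto (fun t : ℝ => Real.exp (t * a)) Filter.atTop (nhds 0) :=
      Real.tendsto_exp_atBot.comp (Filter.tendsto_id.atTop_mul_const_of_neg h)
    have := h1.div (h1.const_add 1) (by norm_num)
    rw [zero_div] at this
    exact this
  · rw [if_pos h]
    have h1 : Filter.Tendsto (fun t : ℝ => Real.exp (-(t * a))) Filter.atTop (nhds 0) :=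
      Real.tendsto_exp_neg_atTop_nhds_zero.comp (Filter.tendsto_id.atTop_mul_const h)
    have := (h1.add_const 1).inv₀ (by norm_num)
    simp only [zero_add, inv_one] at this
    refine this.congr fun t => ?_
    rw [Real.exp_neg]
    field_simp

/-- `C` is cut out of the cube by an open half-space whose boundary avoids the vertices. -/
def IsSlice (C : Set (Fin n → Fin 2)) : Prop :=
  ∃ (w : Fin n → ℝ) (c : ℝ), ∀ v, ∑ j, stateVec v j * w j + c ≠ 0 ∧
    (v ∈ C ↔ 0 < ∑ j, stateVec v j * w j + c)

open Classical in
-- Along the ray `t • θ` the sigmoids tend to the indicators of the slices. Having rank at least `m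
-- + 1` is an open condition, so it already holds at some finite `t`.
theorem le_semialgebraicDim_of_isSlice (C : Fin k → Set (Fin n → Fin 2))
    (hC : ∀ i, IsSlice (C i)) {m : ℕ}
    (hm : m + 1 ≤ Module.finrank ℝ (LinearMap.range
      (slicingMap fun i v => if v ∈ C i then 1 else 0).toLinearMap)) :
    (m : WithBot ℕ∞) ≤ semialgebraicDim (rbmModel n k) := by
  choose w c hwc using hC
  let θ : RBMParam n k → ℝ := Sum.elim (fun ij => w ij.1 ij.2) (Sum.elim 0 c)
  have hθ : ∀ i v, hiddenField v i θ = ∑ j, stateVec v j * w i j + c i := fun i v => by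
    rw [hiddenField_apply]; rfl
  let a : ℝ → Fin k → (Fin n → Fin 2) → ℝ := fun t i v =>
    Real.exp (hiddenField v i (t • θ)) / (1 + Real.exp (hiddenField v i (t • θ)))
  have ha : Filter.Tendsto a Filter.atTop (nhds fun i v => if v ∈ C i then 1 else 0) := by
    refine tendsto_pi_nhds.2 fun i => tendsto_pi_nhds.2 fun v => ?_
    have := tendsto_sigmoid_mul ((hwc i v).1)
    rw [if_congr (hwc i v).2.symm rfl rfl, ← hθ] at this
    simpa [a] using this
  have hT := (continuous_slicingMap (n := n) (k := k)).continuousAt.tendsto.comp ha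
  have hopen := isOpen_setOfPred_nat_le_rank (𝕜 := ℝ) (E := ℝ × (RBMParam n k → ℝ))
    (F := (Fin n → Fin 2) → ℝ) (m + 1)
  have hmem : slicingMap (fun i v => if v ∈ C i then 1 else 0) ∈
      {f : ℝ × (RBMParam n k → ℝ) →L[ℝ] ((Fin n → Fin 2) → ℝ) |
        ((m + 1 : ℕ) : Cardinal) ≤ f.toLinearMap.rank} := by
    change ((m + 1 : ℕ) : Cardinal) ≤ Module.rank ℝ (LinearMap.range _)
    rw [← Module.finrank_eq_rank]
    exact_mod_cast hm
  obtain ⟨t, ht⟩ := (hT.eventually (hopen.mem_nhds hmem)).exists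
  refine le_semialgebraicDim_of_slicingMap (t • θ) ?_
  change ((m + 1 : ℕ) : Cardinal) ≤ Module.rank ℝ (LinearMap.range _) at ht
  rw [← Module.finrank_eq_rank] at ht
  exact_mod_cast ht

open Classical in
theorem semialgebraicDim_of_surjective (C : Fin k → Set (Fin n → Fin 2))
    (hC : ∀ i, IsSlice (C i))
    (hs : Function.Surjective (slicingMap fun i v => if v ∈ C i then 1 else 0)) :
    semialgebraicDim (rbmModel n k) = ((min (n * k + n + k) (2 ^ n - 1) : ℕ) : WithBot ℕ∞) := by
  have h1 : ((2 ^ n - 1 : ℕ) : WithBot ℕ∞) ≤ semialgebraicDim (rbmModel n k) := by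
    refine le_semialgebraicDim_of_isSlice C hC ?_
    rw [LinearMap.range_eq_top.2 hs, finrank_top, Module.finrank_fintype_fun_eq_card]
    simp
  have h2 := semialgebraicDim_rbmModel_le_simplex n k
  have h3 := semialgebraicDim_rbmModel_le n k
  have h4 : 2 ^ n - 1 ≤ n * k + n + k := by exact_mod_cast h1.trans h3
  rw [min_eq_right h4]
  exact le_antisymm h2 h1

open Classical in
theorem semialgebraicDim_of_injective (C : Fin k → Set (Fin n → Fin 2))
    (hC : ∀ i, IsSlice (C i))
    (hs : Function.Injective (slicingMap fun i v => if v ∈ C i then 1 else 0)) :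
    semialgebraicDim (rbmModel n k) = ((min (n * k + n + k) (2 ^ n - 1) : ℕ) : WithBot ℕ∞) := by
  have h1 : ((n * k + n + k : ℕ) : WithBot ℕ∞) ≤ semialgebraicDim (rbmModel n k) := by
    refine le_semialgebraicDim_of_isSlice C hC ?_
    rw [LinearMap.finrank_range_of_inj hs, Module.finrank_prod, Module.finrank_fintype_fun_eq_card]
    simp
    linarith
  have h2 := semialgebraicDim_rbmModel_le_simplex n k
  have h3 := semialgebraicDim_rbmModel_le n k
  have h4 : n * k + n + k ≤ 2 ^ n - 1 := by exact_mod_cast h1.trans h2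
  rw [min_eq_left h4]
  exact le_antisymm h3 h1

end tangent

/-! ### Hamming balls as slices of the cube. -/

section slices

variable {n k : ℕ}

/-- The affine function with linear part `w` and constant term `a` at the vertex `v`. -/
def affineEval (a : ℝ) (w : Fin n → ℝ) (v : Fin n → Fin 2) : ℝ := ∑ j, stateVec v j * w j + a

theorem slicingMap_eq_affineEval (a : Fin k → (Fin n → Fin 2) → ℝ)
    (x : ℝ × (RBMParam n k → ℝ)) (v : Fin n → Fin 2) : slicingMap a x v =
      affineEval x.1 (paramB x.2) v + ∑ i, a i v * affineEval (paramC x.2 i) (paramW x.2 i) v := by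
  simp only [slicingMap_apply, visibleField_apply, hiddenField_apply, affineEval]
  ring

/-- An affine function that vanishes on `S` is zero. -/
def DetectsAffine (S : Set (Fin n → Fin 2)) : Prop :=
  ∀ a w, (∀ v ∈ S, affineEval a w v = 0) → a = 0 ∧ w = 0

theorem DetectsAffine.mono {S T : Set (Fin n → Fin 2)} (h : DetectsAffine S) (hST : S ⊆ T) :
    DetectsAffine T := fun a w hT => h a w fun v hv => hT v (hST hv)

theorem isSlice_of_int (w : Fin n → ℤ) (c : ℤ) :
    IsSlice {v : Fin n → Fin 2 | 0 ≤ ∑ j, ((v j : ℕ) : ℤ) * w j + c} := by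
  -- The form takes integer values at the vertices, so the shift by 1/2 moves the boundary off them.
  refine ⟨fun j => w j, c + 1 / 2, fun v => ?_⟩
  have h : ∑ j, stateVec v j * (w j : ℝ) + ((c : ℝ) + 1 / 2) =
      ((∑ j, ((v j : ℕ) : ℤ) * w j + c : ℤ) : ℝ) + 1 / 2 := by
    push_cast
    simp only [stateVec]
    ring
  rw [h]
  set z := ∑ j, ((v j : ℕ) : ℤ) * w j + c with hz
  constructor
  · intro h0
    have h1 : ((2 * z + 1 : ℤ) : ℝ) = 0 := by push_cast; linarith
    have h2 : 2 * z + 1 = 0 := by exact_mod_cast h1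
    omega
  · rw [Set.mem_ofPred_eq, ← hz]
    constructor
    · intro h0
      have : (0 : ℝ) ≤ z := by exact_mod_cast h0
      linarith
    · intro h0
      by_contra hneg
      have h1 : z ≤ -1 := by omega
      have : (z : ℝ) ≤ -1 := by exact_mod_cast h1
      linarith

/-- The zero vector and the unit vectors of `𝔽₂ⁿ`. -/
def unitVec (o : Option (Fin n)) : Fin n → Fin 2 := o.elim 0 fun j => Pi.single j 1

/-- The Hamming ball of radius one. -/
def hammingBall (c : Fin n → Fin 2) : Set (Fin n → Fin 2) := {v | ∃ o, v = c + unitVec o}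

theorem fin_two_add_self (a : Fin 2) : a + a = 0 := by
  fin_cases a <;> rfl

theorem cube_add_self (v : Fin n → Fin 2) : v + v = 0 := funext fun j => fin_two_add_self (v j)

theorem stateVec_add_single (c : Fin n → Fin 2) (j l : Fin n) :
    stateVec (c + Pi.single j 1) l = stateVec c l + if l = j then 1 - 2 * stateVec c j else 0 := by
  by_cases h : l = j
  · subst h
    rw [if_pos rfl]
    simp only [stateVec, Pi.add_apply, Pi.single_eq_same]
    generalize c l = x
    fin_cases x <;> norm_num
  · simp [stateVec, h]

theorem affineEval_add_single (a : ℝ) (w : Fin n → ℝ) (c : Fin n → Fin 2) (j : Fin n) :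
    affineEval a w (c + Pi.single j 1) = affineEval a w c + (1 - 2 * stateVec c j) * w j := by
  simp only [affineEval, stateVec_add_single, add_mul, Finset.sum_add_distrib, ite_mul, zero_mul,
    Finset.sum_ite_eq', Finset.mem_univ, if_true]
  ring

theorem one_sub_two_mul_stateVec_mul_self (c : Fin n → Fin 2) (j : Fin n) :
    (1 - 2 * stateVec c j) * (1 - 2 * stateVec c j) = 1 := by
  simp only [stateVec]
  generalize c j = x
  fin_cases x <;> norm_num

theorem mem_hammingBall_iff (v c : Fin n → Fin 2) : v ∈ hammingBall c ↔ hammingDist v c ≤ 1 := by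
  constructor
  · rintro ⟨o, rfl⟩
    rw [hammingDist, Finset.card_le_one]
    rcases o with _ | j
    · simp [unitVec]
    · have : ∀ l, (c + unitVec (some j)) l ≠ c l → l = j := by
        intro l hl
        by_contra hne
        exact hl (by simp [unitVec, hne])
      intro a ha b hb
      rw [Finset.mem_filter] at ha hb
      rw [this a ha.2, this b hb.2]
  · intro h
    by_cases hv : v = c
    · exact ⟨none, by simp [unitVec, hv]⟩
    · obtain ⟨j, hj⟩ := Function.ne_iff.1 hv
      refine ⟨some j, funext fun l => ?_⟩
      rw [hammingDist, Finset.card_le_one] at h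
      by_cases hl : l = j
      · subst hl
        simp only [unitVec, Option.elim_some, Pi.add_apply, Pi.single_eq_same]
        generalize v l = x at *
        generalize c l = y at *
        revert x y
        decide
      · have : v l = c l := by
          by_contra hne
          exact hl (h l (by simp [hne]) j (by simp [hj]))
        simp [unitVec, hl, this]

/-- The distance to `c` is affine on the cube, since bits satisfy (x-y)² = y - x(2y-1). -/
theorem isSlice_hammingBall (c : Fin n → Fin 2) : IsSlice (hammingBall c) := by
  convert isSlice_of_int (fun j => 2 * ((c j : ℕ) : ℤ) - 1) (1 - ∑ j, ((c j : ℕ) : ℤ)) using 1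
  ext v
  rw [mem_hammingBall_iff, Set.mem_ofPred_eq]
  have h : (hammingDist v c : ℤ) = ∑ j, ((c j : ℕ) : ℤ) -
      ∑ j, ((v j : ℕ) : ℤ) * (2 * ((c j : ℕ) : ℤ) - 1) := by
    rw [hammingDist, Finset.card_filter, ← Finset.sum_sub_distrib]
    push_cast
    refine Finset.sum_congr rfl fun j _ => ?_
    generalize v j = x
    generalize c j = y
    fin_cases x <;> fin_cases y <;> simp
  omega

/-- The n+1 points of a ball are affinely independent. -/
theorem exists_affineEval_eq_on_hammingBall (c : Fin n → Fin 2) (y : (Fin n → Fin 2) → ℝ) :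
    ∃ a w, ∀ v ∈ hammingBall c, affineEval a w v = y v := by
  let w : Fin n → ℝ := fun j => (1 - 2 * stateVec c j) * (y (c + Pi.single j 1) - y c)
  refine ⟨y c - ∑ j, stateVec c j * w j, w, ?_⟩
  have hc : affineEval (y c - ∑ j, stateVec c j * w j) w c = y c := by simp [affineEval]
  rintro _ ⟨_ | j, rfl⟩
  · simpa [unitVec] using hc
  · change affineEval _ w (c + Pi.single j 1) = y (c + Pi.single j 1)
    rw [affineEval_add_single, hc, ← mul_assoc, one_sub_two_mul_stateVec_mul_self]
    ring

theorem detectsAffine_hammingBall (c : Fin n → Fin 2) : DetectsAffine (hammingBall c) := by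
  intro a w h
  have hc : affineEval a w c = 0 := h c ⟨none, by simp [unitVec]⟩
  have hw : w = 0 := by
    ext j
    have h1 := h (c + Pi.single j 1) ⟨some j, rfl⟩
    rw [affineEval_add_single, hc, zero_add] at h1
    have h2 := one_sub_two_mul_stateVec_mul_self c j
    have h3 : 1 - 2 * stateVec c j ≠ 0 := fun h0 => by rw [h0] at h2; norm_num at h2
    exact (mul_eq_zero.1 h1).resolve_left h3
  refine ⟨?_, hw⟩
  simpa [affineEval, hw] using hc

/-- Hamming balls that cover all vertices but at most one give the full dimension. -/
theorem semialgebraicDim_of_covering (c : Fin k → Fin n → Fin 2) (v₀ : Fin n → Fin 2)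
    (hc : ∀ v, v ≠ v₀ → ∃ i, v ∈ hammingBall (c i)) :
    semialgebraicDim (rbmModel n k) = ((min (n * k + n + k) (2 ^ n - 1) : ℕ) : WithBot ℕ∞) := by
  classical
  refine semialgebraicDim_of_surjective (fun i => hammingBall (c i))
    (fun i => isSlice_hammingBall _) fun y => ?_
  choose o ho using hc
  -- Every vertex other than `v₀` is assigned to one ball containing it. The constant `y v₀` in the
  -- global affine part takes care of `v₀`.
  let y' : Fin k → (Fin n → Fin 2) → ℝ := fun i v =>
    if h : v ≠ v₀ then if o v h = i then y v - y v₀ else 0 else 0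
  choose a w haw using fun i => exists_affineEval_eq_on_hammingBall (c i) (y' i)
  refine ⟨(y v₀, Sum.elim (fun ij => w ij.1 ij.2) (Sum.elim 0 a)), funext fun v => ?_⟩
  rw [slicingMap_eq_affineEval]
  have h1 : ∀ i, (if v ∈ hammingBall (c i) then (1 : ℝ) else 0) * affineEval (a i) (w i) v =
      y' i v := by
    intro i
    split_ifs with h
    · rw [one_mul, haw i v h]
    · rw [zero_mul]
      simp only [y']
      split_ifs with h2 h3
      · exact absurd (h3 ▸ ho v h2) h
      · rfl
      · rfl
  have h2 : ∑ i, y' i v = y v - y v₀ := by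
    by_cases hv : v = v₀
    · simp [y', hv]
    · simp [y', hv]
  have h3 : affineEval (y v₀) 0 v = y v₀ := by simp [affineEval]
  calc _ = affineEval (y v₀) 0 v + ∑ i, y' i v :=
        congrArg₂ (· + ·) rfl (Finset.sum_congr rfl fun i _ => h1 i)
    _ = y v := by rw [h2, h3]; ring

theorem paramExt {θ : RBMParam n k → ℝ} (hW : ∀ i, paramW θ i = 0) (hB : paramB θ = 0)
    (hC : ∀ i, paramC θ i = 0) : θ = 0 := by
  ext (⟨i, j⟩ | j | i)
  · exact congrFun (hW i) j
  · exact congrFun hB j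
  · exact hC i

/-- Disjoint Hamming balls whose complement detects affine functions give the expected
dimension. -/
theorem semialgebraicDim_of_packing (c : Fin k → Fin n → Fin 2)
    (hc : ∀ v i i', v ∈ hammingBall (c i) → v ∈ hammingBall (c i') → i = i')
    (hd : DetectsAffine {v | ∀ i, v ∉ hammingBall (c i)}) :
    semialgebraicDim (rbmModel n k) = ((min (n * k + n + k) (2 ^ n - 1) : ℕ) : WithBot ℕ∞) := by
  classical
  refine semialgebraicDim_of_injective (fun i => hammingBall (c i))
    (fun i => isSlice_hammingBall _) ?_
  rw [injective_iff_map_eq_zero]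
  rintro ⟨s, θ⟩ hx
  have hv := fun v => congrFun hx v
  simp only [slicingMap_eq_affineEval, Pi.zero_apply] at hv
  -- Off the balls only the global affine part is left; once it is zero, each ball sees only its own
  -- term.
  obtain ⟨hs, hB⟩ := hd s (paramB θ) fun v hvS => by
    have h1 := hv v
    rwa [Finset.sum_eq_zero fun i _ => by rw [if_neg (hvS i), zero_mul], add_zero] at h1
  have hi : ∀ i, paramC θ i = 0 ∧ paramW θ i = 0 := fun i =>
    detectsAffine_hammingBall (c i) _ _ fun v hvi => by
      have h1 := hv v
      rw [Finset.sum_eq_single i (fun i' _ hne => by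
        rw [if_neg fun h => hne (hc v i' i h hvi), zero_mul]) (by simp), if_pos hvi, hs, hB] at h1
      simpa [affineEval] using h1
  rw [hs, paramExt (fun i => (hi i).2) hB fun i => (hi i).1]
  rfl

end slices

/-! ### Binary linear codes as sets of centres. -/

section codes

variable {n k : ℕ} {M : Type} [AddCommGroup M]

theorem fin_two_add_val_nsmul (h2 : ∀ x : M, x + x = 0) (a b : Fin 2) (x : M) :
    ((a + b : Fin 2) : ℕ) • x = (a : ℕ) • x + (b : ℕ) • x := by
  fin_cases a <;> fin_cases b <;> simp [h2]

/-- The syndrome homomorphism of the binary code with parity check columns `col`. -/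
def syndrome (h2 : ∀ x : M, x + x = 0) (col : Fin n → M) : (Fin n → Fin 2) →+ M where
  toFun v := ∑ j, (v j : ℕ) • col j
  map_zero' := by simp
  map_add' u v := by
    simp only [Pi.add_apply, fin_two_add_val_nsmul h2, Finset.sum_add_distrib]

variable (h2 : ∀ x : M, x + x = 0) (col : Fin n → M)

theorem syndrome_single (j : Fin n) : syndrome h2 col (Pi.single j 1) = col j := by
  change ∑ l, ((Pi.single j 1 : Fin n → Fin 2) l : ℕ) • col l = col j
  rw [Finset.sum_eq_single j (fun l _ hl => by simp [hl]) (by simp)]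
  simp

/-- The syndrome of a word of weight at most one. -/
def columnOrZero (col : Fin n → M) (o : Option (Fin n)) : M := o.elim 0 col

theorem syndrome_unitVec (o : Option (Fin n)) :
    syndrome h2 col (unitVec o) = columnOrZero col o := by
  rcases o with _ | j
  · exact map_zero _
  · exact syndrome_single h2 col j

theorem columnOrZero_injective {col : Fin n → M} (hi : Function.Injective col)
    (h0 : ∀ j, col j ≠ 0) : Function.Injective (columnOrZero col) := by
  rintro (_ | i) (_ | j) h
  · rfl
  · exact absurd h.symm (h0 j)
  · exact absurd h (h0 i)
  · exact congrArg some (hi h)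

/-- The two error patterns have the same syndrome, and the columns separate errors of weight at most
one. -/
theorem hammingBall_codeword_unique {col : Fin n → M}
    (hcol : Function.Injective (columnOrZero col)) {c c' v : Fin n → Fin 2}
    (hc : syndrome h2 col c = 0) (hc' : syndrome h2 col c' = 0) (hv : v ∈ hammingBall c)
    (hv' : v ∈ hammingBall c') : c = c' := by
  obtain ⟨o, rfl⟩ := hv
  obtain ⟨o', ho⟩ := hv'
  have h := congrArg (syndrome h2 col) ho
  rw [map_add, map_add, hc, hc', zero_add, zero_add, syndrome_unitVec, syndrome_unitVec] at h
  rw [hcol h] at ho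
  exact add_right_cancel ho

theorem card_ker_syndrome_mul_card_range :
    Nat.card (syndrome h2 col).ker * Nat.card (syndrome h2 col).range = 2 ^ n := by
  have h := (syndrome h2 col).ker.card_mul_index
  rw [AddSubgroup.index_ker] at h
  rw [h]
  simp

/-- Fewer Hamming balls than codewords. -/
theorem semialgebraicDim_of_lt_card_code {col : Fin n → M}
    (hcol : Function.Injective (columnOrZero col)) (hk : k < Nat.card (syndrome h2 col).ker) :
    semialgebraicDim (rbmModel n k) = ((min (n * k + n + k) (2 ^ n - 1) : ℕ) : WithBot ℕ∞) := by
  let e := (Finite.equivFin (syndrome h2 col).ker).symm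
  let c : Fin k → Fin n → Fin 2 := fun i => (e (Fin.castLE hk.le i)).1
  have hc : ∀ i, syndrome h2 col (c i) = 0 := fun i => (e (Fin.castLE hk.le i)).2
  refine semialgebraicDim_of_packing c (fun v i i' hi hi' => ?_) ?_
  · have := hammingBall_codeword_unique h2 hcol (hc i) (hc i') hi hi'
    exact Fin.castLE_injective _ (e.injective (Subtype.ext this))
  -- The ball around the unused codeword number `k` is disjoint from all the others.
  · refine (detectsAffine_hammingBall (e ⟨k, hk⟩).1).mono fun v hv i hvi => ?_
    have := hammingBall_codeword_unique h2 hcol (e ⟨k, hk⟩).2 (hc i) hv hvi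
    have h3 := congrArg Fin.val (e.injective (Subtype.ext this))
    simp only [Fin.val_castLE] at h3
    omega

/-- The function `(-1)^{v_j}`. -/
def signChar (j : Fin n) (v : Fin n → Fin 2) : ℝ := 1 - 2 * stateVec v j

theorem signChar_add (j : Fin n) (u v : Fin n → Fin 2) :
    signChar j (u + v) = signChar j u * signChar j v := by
  simp only [signChar, stateVec, Pi.add_apply]
  generalize u j = x
  generalize v j = y
  fin_cases x <;> fin_cases y <;> norm_num

theorem signChar_mul_self (j : Fin n) (v : Fin n → Fin 2) : signChar j v * signChar j v = 1 :=
  one_sub_two_mul_stateVec_mul_self v j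

theorem affineEval_eq_signChar (a : ℝ) (w : Fin n → ℝ) (v : Fin n → Fin 2) :
    affineEval a w v = (a + (∑ j, w j) / 2) - ∑ j, w j / 2 * signChar j v := by
  simp only [affineEval, signChar, Finset.sum_div]
  rw [add_comm, add_sub_assoc, ← Finset.sum_sub_distrib]
  congr 1
  exact Finset.sum_congr rfl fun j _ => by ring

/-- A coset of a linear code detects affine functions if any two coordinates can be separated by
codewords. -/
theorem detectsAffine_coset {σ : M} (hσ : ∃ v, syndrome h2 col v = σ)
    (h1 : ∀ i, ∃ c, syndrome h2 col c = 0 ∧ c i = 1)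
    (hsep : ∀ i j, i ≠ j → ∃ c, syndrome h2 col c = 0 ∧ c i = 1 ∧ c j = 0) :
    DetectsAffine {v | syndrome h2 col v = σ} := by
  classical
  intro a w hvan
  let S : Finset (Fin n → Fin 2) := Finset.univ.filter fun v => syndrome h2 col v = σ
  -- Translation by codewords permutes the coset. Codewords flipping one sign character show that
  -- the constant and the sign characters are orthogonal on the coset.
  have hshift : ∀ (c : Fin n → Fin 2), syndrome h2 col c = 0 → ∀ f : (Fin n → Fin 2) → ℝ,
      ∑ v ∈ S, f (v + c) = ∑ v ∈ S, f v := by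
    intro c hc f
    refine Finset.sum_equiv (Equiv.addRight c) (fun v => ?_) fun v _ => rfl
    simp [S, hc]
  have hneg : ∀ x : Fin 2, x = 1 → (1 : ℝ) - 2 * ((x : ℕ) : ℝ) = -1 := by
    rintro _ rfl; norm_num
  have hpos : ∀ x : Fin 2, x = 0 → (1 : ℝ) - 2 * ((x : ℕ) : ℝ) = 1 := by
    rintro _ rfl; norm_num
  have hsum1 : ∀ i, ∑ v ∈ S, signChar i v = 0 := by
    intro i
    obtain ⟨c, hc, hci⟩ := h1 i
    have h3 := hshift c hc (signChar i)
    have h4 : signChar i c = -1 := hneg _ hci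
    simp only [signChar_add, h4, mul_neg, mul_one, Finset.sum_neg_distrib] at h3
    linarith
  have hsum2 : ∀ i j, i ≠ j → ∑ v ∈ S, signChar i v * signChar j v = 0 := by
    intro i j hij
    obtain ⟨c, hc, hci, hcj⟩ := hsep i j hij
    have h3 := hshift c hc fun v => signChar i v * signChar j v
    have h4 : signChar i c = -1 := hneg _ hci
    have h5 : signChar j c = 1 := hpos _ hcj
    simp only [signChar_add, h4, h5, mul_neg, mul_one, neg_mul, Finset.sum_neg_distrib] at h3
    linarith
  obtain ⟨v₀, hv₀⟩ := hσ
  have hcard : (S.card : ℝ) ≠ 0 := by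
    rw [Nat.cast_ne_zero]
    exact Finset.card_ne_zero_of_mem (Finset.mem_filter.2 ⟨Finset.mem_univ v₀, hv₀⟩)
  have hw : w = 0 := by
    ext i
    have h3 : ∑ v ∈ S, affineEval a w v * signChar i v = 0 :=
      Finset.sum_eq_zero fun v hv => by rw [hvan v (Finset.mem_filter.1 hv).2, zero_mul]
    have h4 : ∑ v ∈ S, affineEval a w v * signChar i v = -(w i / 2 * S.card) := by
      simp only [affineEval_eq_signChar, sub_mul, Finset.sum_sub_distrib, ← Finset.mul_sum,
        hsum1, mul_zero, zero_sub, Finset.sum_mul]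
      rw [Finset.sum_comm, Finset.sum_eq_single i]
      · simp only [mul_assoc, signChar_mul_self, mul_one, Finset.sum_const, nsmul_eq_mul]
        ring
      · intro j _ hji
        simp only [mul_assoc, ← Finset.mul_sum, hsum2 j i hji, mul_zero]
      · simp
    rw [h4, neg_eq_zero, mul_eq_zero, or_iff_left hcard] at h3
    simpa using h3
  refine ⟨?_, hw⟩
  simpa [affineEval, hw] using hvan v₀ hv₀

/-- As many Hamming balls as codewords, when some syndrome is not covered. -/
theorem semialgebraicDim_of_le_card_code {col : Fin n → M} [Finite M]
    (hcol : Function.Injective (columnOrZero col)) (hn : 2 ≤ n)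
    (hk : k * Nat.card M ≤ 2 ^ n) (hσ : n + 1 < Nat.card M)
    (hsep : ∀ i j, i ≠ j → ∃ x : Fin n → Fin 2, syndrome h2 col x = col i ∧ x i = 0 ∧ x j = 0) :
    semialgebraicDim (rbmModel n k) = ((min (n * k + n + k) (2 ^ n - 1) : ℕ) : WithBot ℕ∞) := by
  have hcard := card_ker_syndrome_mul_card_range h2 col
  have hrange : Nat.card (syndrome h2 col).range ≤ Nat.card M :=
    Nat.card_le_card_of_injective _ Subtype.val_injective
  rcases lt_or_ge k (Nat.card (syndrome h2 col).ker) with hlt | hge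
  · exact semialgebraicDim_of_lt_card_code h2 hcol hlt
  have hMpos : 0 < Nat.card M := by omega
  have hkerpos : 0 < Nat.card (syndrome h2 col).ker := Nat.card_pos
  have hrange_eq : Nat.card (syndrome h2 col).range = Nat.card M := by
    refine le_antisymm hrange ?_
    by_contra hlt
    push Not at hlt
    have h3 := Nat.mul_lt_mul_of_pos_left hlt hkerpos
    have h4 := Nat.mul_le_mul_right (Nat.card M) hge
    omega
  have hk_eq : Nat.card (syndrome h2 col).ker = k := by
    refine le_antisymm hge ?_
    rw [hrange_eq] at hcard
    rw [← hcard] at hk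
    exact Nat.le_of_mul_le_mul_right hk hMpos
  have hsurj : Function.Surjective (syndrome h2 col) := by
    rw [← AddMonoidHom.range_eq_top]
    exact AddSubgroup.eq_top_of_card_eq _ hrange_eq
  -- Errors of weight at most one have only n+1 syndromes, so some coset meets no ball.
  obtain ⟨σ, hσ⟩ : ∃ σ, σ ∉ Set.range (columnOrZero col) := by
    by_contra hall
    push Not at hall
    have h3 : Function.Surjective (columnOrZero col) := hall
    have h4 := Nat.card_le_card_of_surjective _ h3
    simp at h4
    omega
  let e := (Finite.equivFinOfCardEq hk_eq).symm
  refine semialgebraicDim_of_packing (fun i => (e i).1) (fun v i i' hi hi' => ?_) ?_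
  · exact e.injective (Subtype.ext (hammingBall_codeword_unique h2 hcol (e i).2 (e i').2 hi hi'))
  · have hsep' : ∀ i j, i ≠ j → ∃ c, syndrome h2 col c = 0 ∧ c i = 1 ∧ c j = 0 := by
      intro i j hij
      obtain ⟨x, hx, hxi, hxj⟩ := hsep i j hij
      refine ⟨x + Pi.single i 1, ?_, ?_, ?_⟩
      · rw [map_add, syndrome_single, hx, h2]
      · simp [hxi]
      · simp [hxj, hij.symm]
    refine (detectsAffine_coset h2 col (hsurj σ) (fun i => ?_) hsep').mono fun v hv i hvi => ?_
    · have : Nontrivial (Fin n) := Fin.nontrivial_iff_two_le.2 hn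
      obtain ⟨j, hj⟩ := exists_ne i
      obtain ⟨c, h3, h4, -⟩ := hsep' i j hj.symm
      exact ⟨c, h3, h4⟩
    · obtain ⟨o, rfl⟩ := hvi
      have h3 : syndrome h2 col ((e i).1 + unitVec o) = σ := hv
      rw [map_add, (e i).2, zero_add, syndrome_unitVec] at h3
      exact hσ ⟨o, h3⟩

/-- Covering by the Hamming balls around the codewords. -/
theorem semialgebraicDim_of_card_code_le (h2 : ∀ x : M, x + x = 0) {col : Fin n → M} [Finite M]
    (hcol : ∀ x, x ≠ 0 → ∃ j, col j = x) (hk : 2 ^ n ≤ k * Nat.card M) :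
    semialgebraicDim (rbmModel n k) = ((min (n * k + n + k) (2 ^ n - 1) : ℕ) : WithBot ℕ∞) := by
  have hsurj : Function.Surjective (syndrome h2 col) := by
    intro x
    by_cases hx : x = 0
    · exact ⟨0, by rw [map_zero, hx]⟩
    · obtain ⟨j, rfl⟩ := hcol x hx
      exact ⟨_, syndrome_single h2 col j⟩
  have hcard := card_ker_syndrome_mul_card_range h2 col
  rw [AddMonoidHom.range_eq_top.2 hsurj, AddSubgroup.card_top] at hcard
  have hle : Nat.card (syndrome h2 col).ker ≤ k := by
    rw [← hcard] at hk
    exact Nat.le_of_mul_le_mul_right hk Nat.card_pos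
  let e := Finite.equivFin (syndrome h2 col).ker
  -- Surplus hidden nodes get the redundant centre 0.
  let c : Fin k → Fin n → Fin 2 := fun i =>
    if h : i.1 < Nat.card (syndrome h2 col).ker then (e.symm ⟨i.1, h⟩).1 else 0
  have hcov : ∀ u, syndrome h2 col u = 0 → ∃ i, c i = u := by
    intro u hu
    refine ⟨Fin.castLE hle (e ⟨u, hu⟩), ?_⟩
    simp only [c, Fin.val_castLE]
    rw [dif_pos (e ⟨u, hu⟩).2]
    simp
  refine semialgebraicDim_of_covering c 0 fun v _ => ?_
  by_cases hv : syndrome h2 col v = 0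
  · obtain ⟨i, hi⟩ := hcov v hv
    exact ⟨i, none, by simp [unitVec, hi]⟩
  · obtain ⟨j, hj⟩ := hcol _ hv
    obtain ⟨i, hi⟩ := hcov (v + Pi.single j 1) (by rw [map_add, syndrome_single, hj, h2])
    refine ⟨i, some j, ?_⟩
    rw [hi]
    change v = v + Pi.single j 1 + Pi.single j 1
    rw [add_assoc, cube_add_self, add_zero]

end codes

/-! ### Small cubes with explicit slices. -/

section small

theorem semialgebraicDim_two_one :
    semialgebraicDim (rbmModel 2 1) = ((min (2 * 1 + 2 + 1) (2 ^ 2 - 1) : ℕ) : WithBot ℕ∞) := by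
  refine semialgebraicDim_of_covering (fun _ => 0) ![1, 1] fun v hv => ⟨0, ?_⟩
  rw [mem_hammingBall_iff]
  revert v
  decide

/-- The vertices of the cube at which the integral affine function is nonnegative. -/
def intSlice {n : ℕ} (w : Fin n → ℤ) (c : ℤ) : Set (Fin n → Fin 2) :=
  {v | 0 ≤ ∑ j, ((v j : ℕ) : ℤ) * w j + c}

theorem affineEval_four (a : ℝ) (w : Fin 4 → ℝ) (x₀ x₁ x₂ x₃ : Fin 2) :
    affineEval a w ![x₀, x₁, x₂, x₃] =
      (x₀ : ℕ) * w 0 + (x₁ : ℕ) * w 1 + (x₂ : ℕ) * w 2 + (x₃ : ℕ) * w 3 + a := by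
  rw [affineEval, Fin.sum_univ_four]
  rfl

theorem mem_intSlice_four (c w₀ w₁ w₂ w₃ : ℤ) (x₀ x₁ x₂ x₃ : Fin 2) :
    ![x₀, x₁, x₂, x₃] ∈ intSlice ![w₀, w₁, w₂, w₃] c ↔
      0 ≤ ((x₀ : ℕ) : ℤ) * w₀ + ((x₁ : ℕ) : ℤ) * w₁ + ((x₂ : ℕ) : ℤ) * w₂ +
        ((x₃ : ℕ) : ℤ) * w₃ + c := by
  rw [intSlice, Set.mem_ofPred_eq, Fin.sum_univ_four]
  rfl

open Classical in
-- Two disjoint balls in the 4-cube leave six vertices lying on a hyperplane. The slices used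
-- instead have six vertices each and share two, and the six uncovered vertices do detect affine
-- functions.
theorem semialgebraicDim_four_two :
    semialgebraicDim (rbmModel 4 2) = ((min (4 * 2 + 4 + 2) (2 ^ 4 - 1) : ℕ) : WithBot ℕ∞) := by
  refine semialgebraicDim_of_injective
    ![intSlice ![2, 2, -3, -3] 0, intSlice ![2, -1, 2, -1] (-2)]
    (Fin.forall_fin_two.2 ⟨isSlice_of_int _ _, isSlice_of_int _ _⟩) ?_
  rw [injective_iff_map_eq_zero]
  rintro ⟨s, θ⟩ hx
  have hv : ∀ x₀ x₁ x₂ x₃ : Fin 2, _ := fun x₀ x₁ x₂ x₃ => congrFun hx ![x₀, x₁, x₂, x₃]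
  simp only [slicingMap_eq_affineEval, Pi.zero_apply, affineEval_four, Fin.sum_univ_two,
    Matrix.cons_val_zero, Matrix.cons_val_one, mem_intSlice_four, Fin.forall_fin_two] at hv
  obtain ⟨⟨⟨⟨e0, e1⟩, ⟨e2, e3⟩⟩, ⟨⟨e4, e5⟩, ⟨e6, e7⟩⟩⟩,
    ⟨⟨⟨e8, e9⟩, ⟨e10, e11⟩⟩, ⟨⟨e12, e13⟩, ⟨e14, e15⟩⟩⟩⟩ := hv
  norm_num at e0 e1 e2 e3 e4 e5 e6 e7 e8 e9 e10 e11 e12 e13 e14 e15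
  have hs : s = 0 := by linarith
  have hB : paramB θ = 0 := by
    ext j
    fin_cases j <;> simp only [Fin.zero_eta, Fin.mk_one, Fin.reduceFinMk, Pi.zero_apply] <;>
      linarith
  have hW : ∀ i, paramW θ i = 0 := by
    intro i
    ext j
    fin_cases i <;> fin_cases j <;>
      simp only [Fin.zero_eta, Fin.mk_one, Fin.reduceFinMk, Pi.zero_apply] <;> linarith
  have hC : ∀ i, paramC θ i = 0 := by
    intro i
    fin_cases i <;> simp only [Fin.zero_eta, Fin.mk_one] <;> linarith
  rw [hs, paramExt hW hB hC]
  rfl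

theorem affineEval_five (a : ℝ) (w : Fin 5 → ℝ) (x₀ x₁ x₂ x₃ x₄ : Fin 2) :
    affineEval a w ![x₀, x₁, x₂, x₃, x₄] = (x₀ : ℕ) * w 0 + (x₁ : ℕ) * w 1 +
      (x₂ : ℕ) * w 2 + (x₃ : ℕ) * w 3 + (x₄ : ℕ) * w 4 + a := by
  rw [affineEval, Fin.sum_univ_five]
  rfl

theorem mem_intSlice_five (c w₀ w₁ w₂ w₃ w₄ : ℤ) (x₀ x₁ x₂ x₃ x₄ : Fin 2) :
    ![x₀, x₁, x₂, x₃, x₄] ∈ intSlice ![w₀, w₁, w₂, w₃, w₄] c ↔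
      0 ≤ ((x₀ : ℕ) : ℤ) * w₀ + ((x₁ : ℕ) : ℤ) * w₁ + ((x₂ : ℕ) : ℤ) * w₂ +
        ((x₃ : ℕ) : ℤ) * w₃ + ((x₄ : ℕ) : ℤ) * w₄ + c := by
  rw [intSlice, Set.mem_ofPred_eq, Fin.sum_univ_five]
  rfl

open Classical in
-- A coset of a code with four words has too few points to detect affine functions on the 5-cube,
-- which takes six. The slices are the balls about 00000, 11100 and 00111, and the majority
-- condition on 1-v₀, v₂, v₄.
theorem semialgebraicDim_five_four :
    semialgebraicDim (rbmModel 5 4) = ((min (5 * 4 + 5 + 4) (2 ^ 5 - 1) : ℕ) : WithBot ℕ∞) := by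
  let w : Fin 4 → Fin 5 → ℤ :=
    ![![-1, -1, -1, -1, -1], ![1, 1, 1, -1, -1], ![-1, -1, 1, 1, 1], ![-1, 0, 1, 0, 1]]
  let c : Fin 4 → ℤ := ![1, -2, -2, -1]
  refine semialgebraicDim_of_injective (fun i => intSlice (w i) (c i))
    (fun i => isSlice_of_int _ _) ?_
  rw [injective_iff_map_eq_zero]
  rintro ⟨s, θ⟩ hx
  have hv : ∀ x₀ x₁ x₂ x₃ x₄ : Fin 2, _ :=
    fun x₀ x₁ x₂ x₃ x₄ => congrFun hx ![x₀, x₁, x₂, x₃, x₄]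
  have hw : w 0 = ![-1, -1, -1, -1, -1] ∧ w 1 = ![1, 1, 1, -1, -1] ∧ w 2 = ![-1, -1, 1, 1, 1] ∧
    w 3 = ![-1, 0, 1, 0, 1] ∧ c 0 = 1 ∧ c 1 = -2 ∧ c 2 = -2 ∧ c 3 = -1 :=
    ⟨rfl, rfl, rfl, rfl, rfl, rfl, rfl, rfl⟩
  simp only [slicingMap_eq_affineEval, Pi.zero_apply, affineEval_five, Fin.sum_univ_four,
    hw, mem_intSlice_five, Fin.forall_fin_two] at hv
  obtain ⟨⟨⟨⟨⟨e0, e1⟩, ⟨e2, e3⟩⟩, ⟨⟨e4, e5⟩, ⟨e6, e7⟩⟩⟩,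
      ⟨⟨⟨e8, e9⟩, ⟨e10, e11⟩⟩, ⟨⟨e12, e13⟩, ⟨e14, e15⟩⟩⟩⟩,
    ⟨⟨⟨⟨e16, e17⟩, ⟨e18, e19⟩⟩, ⟨⟨e20, e21⟩, ⟨e22, e23⟩⟩⟩,
      ⟨⟨⟨e24, e25⟩, ⟨e26, e27⟩⟩, ⟨⟨e28, e29⟩, ⟨e30, e31⟩⟩⟩⟩⟩ := hv
  norm_num at e0 e1 e2 e3 e4 e5 e6 e7 e8 e9 e10 e11 e12 e13 e14 e15 e16 e17 e18 e19 e20 e21 e22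
  norm_num at e23 e24 e25 e26 e27 e28 e29 e30 e31
  have hs : s = 0 := by linarith
  have hB : paramB θ = 0 := by
    ext j
    fin_cases j <;> simp only [Fin.zero_eta, Fin.mk_one, Fin.reduceFinMk, Pi.zero_apply] <;>
      linarith
  have hW : ∀ i, paramW θ i = 0 := by
    intro i
    ext j
    fin_cases i <;> fin_cases j <;>
      simp only [Fin.zero_eta, Fin.mk_one, Fin.reduceFinMk, Pi.zero_apply] <;> linarith
  have hC : ∀ i, paramC θ i = 0 := by
    intro i
    fin_cases i <;> simp only [Fin.zero_eta, Fin.mk_one, Fin.reduceFinMk] <;> linarith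
  rw [hs, paramExt hW hB hC]
  rfl

end small

/-! ### Choice of the parity check columns, and conclusion. -/

section codes

/-- The columns are the binary numerals 1 to 6, so the syndrome 7 is uncovered. Each column is the
sum of two others avoiding any prescribed `j`, which yields the separating codewords. -/
theorem semialgebraicDim_six {k : ℕ} (hk : k * 8 ≤ 2 ^ 6) :
    semialgebraicDim (rbmModel 6 k) = ((min (6 * k + 6 + k) (2 ^ 6 - 1) : ℕ) : WithBot ℕ∞) := by
  let col : Fin 6 → Fin 2 × Fin 2 × Fin 2 :=
    ![(0, 0, 1), (0, 1, 0), (0, 1, 1), (1, 0, 0), (1, 0, 1), (1, 1, 0)]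
  have hcard : Nat.card (Fin 2 × Fin 2 × Fin 2) = 8 := by simp
  have hM : ∀ x : Fin 2 × Fin 2 × Fin 2, x + x = 0 := by decide
  have hpair : ∀ i j : Fin 6, i ≠ j →
      ∃ a b, a ≠ i ∧ a ≠ j ∧ b ≠ i ∧ b ≠ j ∧ col a + col b = col i := by decide
  refine semialgebraicDim_of_le_card_code hM (col := col) ?_ (by norm_num) (hcard ▸ hk)
    (by rw [hcard]; norm_num) ?_
  · exact columnOrZero_injective (by decide) (by decide)
  · intro i j hij
    obtain ⟨a, b, hai, haj, hbi, hbj, h⟩ := hpair i j hij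
    refine ⟨Pi.single a 1 + Pi.single b 1, ?_, ?_, ?_⟩
    · rw [map_add, syndrome_single, syndrome_single, h]
    · simp [hai.symm, hbi.symm]
    · simp [haj.symm, hbj.symm]

theorem exists_notMem_of_card_lt {α : Type*} [Fintype α] [DecidableEq α] {s : Finset α}
    (h : s.card < Fintype.card α) : ∃ x, x ∉ s := by
  by_contra! hs
  exact absurd (Finset.card_le_card fun x _ => hs x : (Finset.univ : Finset α).card ≤ s.card)
    (by simpa using h)

variable {G : Type} [AddCommGroup G] [Fintype G]

/-- A matrix of parity check columns which contains all the vectors with last coordinate `1`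
separates its columns. -/
theorem exists_syndrome_eq_of_affine_columns {n : ℕ} (hG : ∀ x : G, x + x = 0)
    (h2 : ∀ x : G × Fin 2, x + x = 0) (hcard : 4 < Fintype.card G) {col : Fin n → G × Fin 2}
    (idx : G → Fin n) (hidx : ∀ x, col (idx x) = (x, 1)) (i j : Fin n) :
    ∃ x : Fin n → Fin 2, syndrome h2 col x = col i ∧ x i = 0 ∧ x j = 0 := by
  classical
  have hne : ∀ {z l}, z ≠ (col l).1 → l ≠ idx z := fun h hl => h (by rw [hl, hidx])
  have hcan : ∀ x y : G, x + (x + y) = y := fun x y => by rw [← add_assoc, hG, zero_add]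
  have heq : ∀ {x y z : G}, x + y = z → y = x + z := fun {x y z} h => by rw [← h, hcan]
  set q := (col j).1
  obtain ⟨p, t, hi⟩ : ∃ p t, col i = (p, t) := ⟨_, _, rfl⟩
  have hp : (col i).1 = p := by rw [hi]
  have hfour : ∀ a b c d : G, ∃ z, z ≠ a ∧ z ≠ b ∧ z ≠ c ∧ z ≠ d := by
    intro a b c d
    obtain ⟨z, hz⟩ := exists_notMem_of_card_lt
      ((Finset.card_le_four (a := a) (b := b) (c := c) (d := d)).trans_lt hcard)
    exact ⟨z, by simpa using hz⟩
  have hpi : ∀ {z}, z ≠ p → i ≠ idx z := fun h => hne (hp.symm ▸ h)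
  obtain rfl | rfl : t = 0 ∨ t = 1 := by
    clear hi
    revert t
    decide
  -- Here (p,0) = (z,1) + (p+z,1); the four excluded values of `z` keep both columns away from `i`
  -- and `j`.
  · obtain ⟨z, h1, h2', h3, h4⟩ := hfour p q 0 (p + q)
    have h5 : p + z ≠ p := fun h => h3 (by rw [heq h, hG])
    have h6 : p + z ≠ q := fun h => h4 (heq h)
    refine ⟨Pi.single (idx z) 1 + Pi.single (idx (p + z)) 1, ?_, ?_, ?_⟩
    · rw [map_add, syndrome_single, syndrome_single, hidx, hidx, hi, Prod.mk_add_mk,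
        add_left_comm, hG, add_zero]
      rfl
    · simp [hpi h1, hpi h5]
    · simp [hne h2', hne h6]
  -- By parity of the last coordinate three columns are needed: (p,1) = (u,1) + (w,1) + (p+u+w,1).
  · obtain ⟨u, h1, h2', -, -⟩ := hfour p q p q
    obtain ⟨w, h3, h4, h5, h6⟩ := hfour p q u (u + (p + q))
    have h7 : p + (u + w) ≠ p := fun h => h5 (by rw [heq (heq h), hG, add_zero])
    have h8 : p + (u + w) ≠ q := fun h => h6 (heq (heq h))
    refine ⟨Pi.single (idx u) 1 + Pi.single (idx w) 1 + Pi.single (idx (p + (u + w))) 1,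
      ?_, ?_, ?_⟩
    · rw [map_add, map_add, syndrome_single, syndrome_single, syndrome_single, hidx, hidx, hidx, hi,
        Prod.mk_add_mk, Prod.mk_add_mk, add_left_comm, hG, add_zero]
      rfl
    · simp [hpi h1, hpi h3, hpi h7]
    · simp [hne h2', hne h4, hne h8]

/-- The expected dimension for the codes whose parity check columns contain all the vectors with
last coordinate `1`. -/
theorem semialgebraicDim_of_card_le_of_lt {n k : ℕ} (hG : ∀ x : G, x + x = 0)
    (h4 : 4 < Fintype.card G) (hle : Fintype.card G ≤ n) (hlt : n + 1 < 2 * Fintype.card G)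
    (hk : k * (2 * Fintype.card G) ≤ 2 ^ n) :
    semialgebraicDim (rbmModel n k) = ((min (n * k + n + k) (2 ^ n - 1) : ℕ) : WithBot ℕ∞) := by
  classical
  have h2 : ∀ x : G × Fin 2, x + x = 0 := fun x => Prod.ext (hG x.1) (fin_two_add_self x.2)
  have hcard : Fintype.card (G × Fin 2) = 2 * Fintype.card G := by
    rw [Fintype.card_prod, Fintype.card_fin, mul_comm]
  let A : Finset (G × Fin 2) := Finset.univ.map ⟨fun x => (x, 1), fun _ _ h => (Prod.ext_iff.1 h).1⟩
  have hA : A.card = Fintype.card G := by simp [A]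
  obtain ⟨T, hAT, hT, hTn⟩ : ∃ T, A ⊆ T ∧ T ⊆ Finset.univ.erase 0 ∧ T.card = n := by
    refine Finset.exists_subsuperset_card_eq ?_ (hA ▸ hle) ?_
    · intro x hx
      obtain ⟨y, -, rfl⟩ := Finset.mem_map.1 hx
      exact Finset.mem_erase.2 ⟨fun h => absurd (Prod.ext_iff.1 h).2 (by decide : (1 : Fin 2) ≠ 0),
        Finset.mem_univ _⟩
    · rw [Finset.card_erase_of_mem (Finset.mem_univ _), Finset.card_univ, hcard]
      omega
  let e : Fin n ≃ T := (T.equivFinOfCardEq hTn).symm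
  have hmem : ∀ x : G, (x, 1) ∈ T := fun x => hAT (Finset.mem_map_of_mem _ (Finset.mem_univ x))
  refine semialgebraicDim_of_le_card_code h2 (col := fun j => (e j : G × Fin 2)) ?_ (by omega) ?_ ?_
    fun i j _ => exists_syndrome_eq_of_affine_columns hG h2 h4
      (fun x => e.symm ⟨(x, 1), hmem x⟩) (fun x => by simp) i j
  · exact columnOrZero_injective (Subtype.val_injective.comp e.injective)
      fun j => (Finset.mem_erase.1 (hT (e j).2)).1
  · rwa [Nat.card_eq_fintype_card, hcard]
  · rwa [Nat.card_eq_fintype_card, hcard]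

/-- The expected dimension for codes with `m` parity checks. -/
theorem semialgebraicDim_of_mul_two_pow_le {n k m : ℕ} (hn : n + 1 ≤ 2 ^ m)
    (hm : 2 ^ m < 2 * (n + 1)) (hk : k * 2 ^ m ≤ 2 ^ n) :
    semialgebraicDim (rbmModel n k) = ((min (n * k + n + k) (2 ^ n - 1) : ℕ) : WithBot ℕ∞) := by
  have h2 : ∀ x : Fin m → Fin 2, x + x = 0 := cube_add_self
  have hcard : Fintype.card (Fin m → Fin 2) = 2 ^ m := by simp
  have hcard' : Nat.card (Fin m → Fin 2) = 2 ^ m := by simp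
  have hc : Fintype.card {x : Fin m → Fin 2 // x ≠ 0} = 2 ^ m - 1 := by
    rw [Fintype.card_subtype_compl, hcard]
    simp
  obtain ⟨col⟩ : Nonempty (Fin n ↪ {x : Fin m → Fin 2 // x ≠ 0}) :=
    Function.Embedding.nonempty_of_card_le (by rw [hc, Fintype.card_fin]; omega)
  have hcol : Function.Injective (columnOrZero fun j => (col j).1) :=
    columnOrZero_injective (Subtype.val_injective.comp col.injective) fun j => (col j).2
  rcases hk.lt_or_eq with hlt | heq
  · refine semialgebraicDim_of_lt_card_code h2 hcol ?_
    rw [← card_ker_syndrome_mul_card_range h2 fun j => (col j).1] at hlt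
    refine lt_of_mul_lt_mul_right (hlt.trans_le ?_) (Nat.zero_le (2 ^ m))
    exact Nat.mul_le_mul_left _ (hcard' ▸ Nat.card_le_card_of_injective _ Subtype.val_injective)
  -- Now `k * 2 ^ m = 2 ^ n`. If `n + 1 = 2 ^ m`, the code is a perfect Hamming code and its balls
  -- cover the cube.
  rcases hn.lt_or_eq with hlt | hn
  swap
  · have hsurj : Function.Surjective col :=
      ((Fintype.bijective_iff_injective_and_card col).2
        ⟨col.injective, by rw [hc, Fintype.card_fin]; omega⟩).2
    refine semialgebraicDim_of_card_code_le h2 (col := fun j => (col j).1) (fun x hx => ?_)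
      (by rw [hcard', heq])
    obtain ⟨j, hj⟩ := hsurj ⟨x, hx⟩
    exact ⟨j, by rw [hj]⟩
  -- The columns with last coordinate 1 form a group of order `2 ^ (m - 1)` in their first
  -- coordinate, which must exceed 4.
  by_cases hm4 : 4 ≤ m
  · obtain ⟨r, rfl⟩ : ∃ r, m = r + 1 := ⟨m - 1, by omega⟩
    have h8 : 2 ^ 3 ≤ 2 ^ r := Nat.pow_le_pow_right (by norm_num) (by omega)
    have hr : Fintype.card (Fin r → Fin 2) = 2 ^ r := by simp
    refine semialgebraicDim_of_card_le_of_lt (G := Fin r → Fin 2) cube_add_self ?_ ?_ ?_ ?_ <;>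
      rw [hr] <;> rw [pow_succ'] at * <;> omega
  · interval_cases m
    · omega
    · omega
    · obtain rfl : n = 2 := by omega
      obtain rfl : k = 1 := by omega
      exact semialgebraicDim_two_one
    · obtain rfl | rfl | rfl : n = 4 ∨ n = 5 ∨ n = 6 := by omega
      · obtain rfl : k = 2 := by omega
        exact semialgebraicDim_four_two
      · obtain rfl : k = 4 := by omega
        exact semialgebraicDim_five_four
      · exact semialgebraicDim_six hk

/-- The columns exhaust the nonzero vectors, and the remaining coordinates get the column 0: a
covering does not need distinct columns. -/
theorem semialgebraicDim_of_le_mul_two_pow {n k m : ℕ} (hm : 2 ^ m ≤ n + 1)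
    (hk : 2 ^ n ≤ k * 2 ^ m) :
    semialgebraicDim (rbmModel n k) = ((min (n * k + n + k) (2 ^ n - 1) : ℕ) : WithBot ℕ∞) := by
  have hcard : Fintype.card (Fin m → Fin 2) = 2 ^ m := by simp
  have hc : Fintype.card {x : Fin m → Fin 2 // x ≠ 0} = 2 ^ m - 1 := by
    rw [Fintype.card_subtype_compl, hcard]
    simp
  obtain ⟨f⟩ : Nonempty ({x : Fin m → Fin 2 // x ≠ 0} ↪ Fin n) :=
    Function.Embedding.nonempty_of_card_le (by rw [hc, Fintype.card_fin]; omega)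
  refine semialgebraicDim_of_card_code_le cube_add_self
    (col := Function.extend f Subtype.val fun _ => 0) (fun x hx => ⟨f ⟨x, hx⟩, ?_⟩)
    (by simpa using hk)
  exact f.injective.extend_apply _ _ _

end codes

theorem theorem1p2 (n k : ℕ) :
    rbmModel n k ⊆ openSimplex (Fin n → Fin 2) ∧
    IsSemialgebraic (rbmModel n k) ∧
    ((k : ℝ) ≤ (2 : ℝ) ^ ((n : ℤ) - ⌈Real.logb 2 ((n : ℝ) + 1)⌉) →
      semialgebraicDim (rbmModel n k) = ((min (n * k + n + k) (2 ^ n - 1) : ℕ) : WithBot ℕ∞)) ∧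
    ((2 : ℝ) ^ ((n : ℤ) - ⌊Real.logb 2 ((n : ℝ) + 1)⌋) ≤ (k : ℝ) →
      semialgebraicDim (rbmModel n k) = ((min (n * k + n + k) (2 ^ n - 1) : ℕ) : WithBot ℕ∞)) := by
  have hcast : (n : ℝ) + 1 = ((n + 1 : ℕ) : ℝ) := by push_cast; rfl
  have hceil : ⌈Real.logb 2 ((n : ℝ) + 1)⌉ = (Nat.clog 2 (n + 1) : ℤ) := by
    rw [hcast]
    exact_mod_cast (Real.ceil_logb_natCast (b := 2) (r := ((n + 1 : ℕ) : ℝ)) (by positivity)).trans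
      (Int.clog_natCast 2 (n + 1))
  have hfloor : ⌊Real.logb 2 ((n : ℝ) + 1)⌋ = (Nat.log 2 (n + 1) : ℤ) := by
    rw [hcast]
    exact_mod_cast (Real.floor_logb_natCast (b := 2) (r := ((n + 1 : ℕ) : ℝ)) (by positivity)).trans
      (Int.log_natCast 2 (n + 1))
  have hpow : ∀ m : ℕ, (2 : ℝ) ^ ((n : ℤ) - (m : ℤ)) = 2 ^ n / 2 ^ m := fun m => by
    rw [zpow_sub₀ two_ne_zero, zpow_natCast, zpow_natCast]
  refine ⟨rbmModel_subset_openSimplex n k, isSemialgebraic_rbmModel n k, fun h => ?_, fun h => ?_⟩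
  · rw [hceil, hpow, le_div_iff₀ (by positivity)] at h
    refine semialgebraicDim_of_mul_two_pow_le (Nat.le_pow_clog one_lt_two (n + 1)) ?_
      (by exact_mod_cast h)
    -- For `n = 0` the ceiling logarithm is 0, and the bound through its predecessor is unavailable.
    by_cases hn : n = 0
    · simp [hn]
    · have hlt := Nat.pow_pred_clog_lt_self one_lt_two (show 1 < n + 1 by omega)
      have hpos := Nat.clog_pos one_lt_two (show 2 ≤ n + 1 by omega)
      rw [← Nat.succ_pred_eq_of_pos hpos, pow_succ]
      omega
  · rw [hfloor, hpow, div_le_iff₀ (by positivity)] at h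
    exact semialgebraicDim_of_le_mul_two_pow (Nat.pow_log_le_self 2 (Nat.succ_ne_zero n))
      (by exact_mod_cast h)
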